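/- Let $V$ be a vector space over a field $\mathbb{F}$ with a linearly ordered basis $\mathbb{B}$, and let $p,t\in\mathbb{F}\setminus\{0\}$. For $a,b\in\mathbb{B}$ let $\theta_{a,b}=1$ if $a>b$ and $\theta_{a,b}=0$ otherwise; for finite subsets $A,B\subseteq\mathbb{B}$ let $\theta_{A,B}=\sum_{a\in A}\sum_{b\in B}\theta_{a,b}$. Let $\tau\colon V\otimes V\to V\otimes V$ be the braiding $$\tau(a\otimes b)=(p^{\theta_{a,b}}-1)\,a\otimes b-p^{\theta_{b,a}}\,b\otimes a\qquad(a,b\in\mathbb{B}),$$ and let $\Lambda_p(V)$ be the exterior algebra of $V$ (with product $\nabla$) equipped with its braided Hopf algebra structure whose braiding $\hat\tau$ is induced by $\tau$ and in which all elements of $V$ are primitive; let $\Delta$ and $S$ be its coproduct and antipode. For a finite $E\subseteq\mathbb{B}$ let $f_E\in\Lambda_p(V)$ be the product of the elements of $E$ in increasing order; these elements form a basis of $\Lambda_p(V)$. Let $\phi_t$ be the algebra automorphism which multiplies the elements of $V$ by $t$, let $$\lambda_R=\nabla(\nabla\otimes\mathrm{id})\big((S\phi_t)\otimes\mathrm{id}\otimes\mathrm{id}\big)(\hat\tau\otimes\mathrm{id})(\mathrm{id}\otimes\Delta)\colon\Lambda_p(V)\otimes\Lambda_p(V)\to\Lambda_p(V),$$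 and let $\rho=(\phi_t\otimes\lambda_R)(\hat\tau\otimes\mathrm{id})(\mathrm{id}\otimes\Delta)$, an endomorphism of $\Lambda_p(V)\otimes\Lambda_p(V)$. For finite $E,F\subseteq\mathbb{B}$, $G\subseteq E\setminus F$ and $H\subseteq F\setminus E$ put $$E'=(E\setminus G)\sqcup H,\quad F'=(F\setminus H)\sqcup G,\quad C=E\cap F,\quad \dot F=(F\setminus E)\setminus H,$$ $$\alpha_{G,H}=\prod_{a\in G}\big(p^{\theta_{\{a\},H}-\theta_{\{a\},G}}-1\big),\qquad \beta_{E,G;F,H}=(-1)^{\theta_{F,E}+\theta_{F',E'}}\,p^{\theta_{G\sqcup C,E}+\theta_{\dot F,E'}}\,\alpha_{G,H},$$ and $(x;p)_n=\prod_{i=0}^{n-1}(1-xp^i)$. Then, for all finite $E,F\subseteq\mathbb{B}$, $$\rho(f_E\otimes f_F)=(-1)^{|E||F|}\sum_{G,H} r_{E,G;F,H}\;f_{F'}\otimes f_{E'},$$ where the sum runs over all $G\subseteq E\setminus F$ and $H\subseteq F\setminus E$ with $|G|\le|H|$, where $r_{E,G;F,H}$ denotes $(-1)^{|E||F|}$ times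 the coefficient of $f_{F'}\otimes f_{E'}$ in $\rho(f_E\otimes f_F)$, and these coefficients are given by $$r_{E,G;F,H}=t^{|F'|}\,(tp^{|E|};p)_{|H|-|G|}\,\beta_{E,G;F,H}.$$ -/

import Mathlib

open scoped TensorProduct

noncomputable section

namespace HeckeExterior

/-! The braided Hopf algebra `Λ_p(V)`.  Its algebra is the exterior algebra of `V`.  Its braiding
`τ̂`, coproduct `Δ` and antipode `S` are induced from the tensor algebra: they are determined by
the Hecke braiding `τ` on `V ⊗ V`, the compatibility of `τ̂` with the unit and the product, the
primitivity of the elements of `V`, the compatibility of `Δ` with the product, and the antipode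
axiom.  They are built here one generator at a time, through the universal property of the exterior
algebra, and shown at the end of the construction to obey all these rules. -/

variable {𝔽 V ι : Type*} [Field 𝔽] [AddCommGroup V] [Module 𝔽 V] [LinearOrder ι]

set_option linter.unusedSectionVars false

/-- The Heaviside symbol: `1` if `a > b`, and `0` otherwise. -/
def theta (a b : ι) : ℕ := if b < a then 1 else 0

/-- The Hecke braiding `τ` on `V ⊗ V`. -/
def hecke (b : Module.Basis ι 𝔽 V) (p : 𝔽) : V ⊗[𝔽] V →ₗ[𝔽] V ⊗[𝔽] V :=
  (b.tensorProduct b).constr 𝔽 fun ij =>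
    (p ^ theta ij.1 ij.2 - 1) • (b ij.1 ⊗ₜ[𝔽] b ij.2) - p ^ theta ij.2 ij.1 • (b ij.2 ⊗ₜ[𝔽] b ij.1)

theorem hecke_basis (b : Module.Basis ι 𝔽 V) (p : 𝔽) (i j : ι) :
    hecke b p (b i ⊗ₜ[𝔽] b j) =
      (p ^ theta i j - 1) • (b i ⊗ₜ[𝔽] b j) - p ^ theta j i • (b j ⊗ₜ[𝔽] b i) := by
  have h := (b.tensorProduct b).constr_basis 𝔽 (fun ij : ι × ι =>
    (p ^ theta ij.1 ij.2 - 1) • (b ij.1 ⊗ₜ[𝔽] b ij.2) -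
      p ^ theta ij.2 ij.1 • (b ij.2 ⊗ₜ[𝔽] b ij.1)) (i, j)
  rwa [Module.Basis.tensorProduct_apply] at h

/-- `x ↦ (y ⊗ v ↦ x y ⊗ v)`. -/
def leftMul : ExteriorAlgebra 𝔽 V →ₗ[𝔽] Module.End 𝔽 (ExteriorAlgebra 𝔽 V ⊗[𝔽] V) :=
  LinearMap.rTensorHom V ∘ₗ LinearMap.mul 𝔽 (ExteriorAlgebra 𝔽 V)

@[simp] theorem leftMul_tmul (x y : ExteriorAlgebra 𝔽 V) (v : V) :
    leftMul x (y ⊗ₜ[𝔽] v) = (x * y) ⊗ₜ[𝔽] v := rfl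

/-- If `g : V → Λ ⊗ V` stands for `v ↦ τ̂(v ⊗ x)`, then `crossStep b p w g` stands for
`v ↦ τ̂(v ⊗ w x) = (∇ ⊗ id)(id ⊗ g)(τ(v ⊗ w))`. -/
def crossStep (b : Module.Basis ι 𝔽 V) (p : 𝔽) :
    V →ₗ[𝔽] Module.End 𝔽 (V →ₗ[𝔽] ExteriorAlgebra 𝔽 V ⊗[𝔽] V) :=
  LinearMap.mk₂ 𝔽
    (fun w g => TensorProduct.lift ((leftMul ∘ₗ ExteriorAlgebra.ι 𝔽).compl₂ g) ∘ₗ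
      hecke b p ∘ₗ (TensorProduct.mk 𝔽 V V).flip w)
    (fun w w' g => by ext; simp)
    (fun c w g => by ext; simp)
    (fun w g g' => by
      ext v
      simp only [LinearMap.comp_apply, LinearMap.add_apply]
      induction hecke b p ((TensorProduct.mk 𝔽 V V).flip w v) using TensorProduct.induction_on with
      | zero => simp
      | tmul x y => simp
      | add x y hx hy => rw [map_add, map_add, map_add, hx, hy]; abel)
    (fun c w g => by
      ext v
      simp only [LinearMap.comp_apply, LinearMap.smul_apply]
      induction hecke b p ((TensorProduct.mk 𝔽 V V).flip w v) using TensorProduct.induction_on with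
      | zero => simp
      | tmul x y => simp
      | add x y hx hy => rw [map_add, map_add, hx, hy, smul_add])

theorem crossStep_basis (b : Module.Basis ι 𝔽 V) (p : 𝔽) (i k : ι) (g : V →ₗ[𝔽] ExteriorAlgebra 𝔽 V ⊗[𝔽] V) :
    crossStep b p (b k) g (b i) =
      (p ^ theta i k - 1) • leftMul (ExteriorAlgebra.ι 𝔽 (b i)) (g (b k)) -
        p ^ theta k i • leftMul (ExteriorAlgebra.ι 𝔽 (b k)) (g (b i)) := by
  simp [crossStep, hecke_basis]

/-- A quadratic map coming from a linear one vanishes as soon as it does on a basis. -/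
theorem sq_zero_of_basis {A : Type*} [Semiring A] [Algebra 𝔽 A] (b : Module.Basis ι 𝔽 V)
    (f : V →ₗ[𝔽] A) (h : ∀ i j, f (b i) * f (b j) + f (b j) * f (b i) = 0)
    (h' : ∀ i, f (b i) * f (b i) = 0) (v : V) : f v * f v = 0 := by
  have key : ∀ u w, f u * f w + f w * f u = 0 := by
    intro u w
    have : (LinearMap.mul 𝔽 A).compl₁₂ f f + ((LinearMap.mul 𝔽 A).compl₁₂ f f).flip = 0 := by
      refine b.ext fun i => b.ext fun j => ?_
      simpa using h i j
    simpa using congr($this u w)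
  have hv : v ∈ Submodule.span 𝔽 (Set.range b) := by simp [b.span_eq]
  induction hv using Submodule.span_induction with
  | mem x hx => obtain ⟨i, rfl⟩ := hx; exact h' i
  | zero => simp
  | add u w _ _ hu hw =>
    rw [map_add, add_mul, mul_add, mul_add, hu, hw, zero_add, add_zero, key]
  | smul c u _ hu => rw [map_smul, smul_mul_smul_comm, hu, smul_zero]

theorem theta_of_lt {a b : ι} (h : a < b) : theta a b = 0 := if_neg h.not_gt
theorem theta_of_gt {a b : ι} (h : b < a) : theta a b = 1 := if_pos h
theorem theta_self (a : ι) : theta a a = 0 := if_neg (lt_irrefl a)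

theorem hecke_poly (p : 𝔽) (i j k : ι) (hik : i ≠ k) : (p ^ theta k i - 1) * (p ^ theta i j - 1)
    + p ^ theta i k * (p ^ theta k j - 1) - (p ^ theta k j - 1) * p ^ theta i j = 0 := by
  by_cases hij : i = j
  · subst hij
    rcases lt_or_gt_of_ne hik with h | h <;>
      simp only [theta_self, theta_of_lt h, theta_of_gt h, pow_zero, pow_one] <;> ring
  · by_cases hjk : k = j
    · subst hjk
      rcases lt_or_gt_of_ne hik with h | h <;>
        simp only [theta_self, theta_of_lt h, theta_of_gt h, pow_zero, pow_one] <;> ring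
    · rcases lt_or_gt_of_ne hik with h1 | h1 <;> rcases lt_or_gt_of_ne hij with h2 | h2 <;>
        rcases lt_or_gt_of_ne hjk with h3 | h3 <;>
        first
        | exact absurd (h1.trans h3) h2.not_gt
        | exact absurd (h3.trans h1) h2.not_gt
        | (simp only [theta_of_lt h1, theta_of_gt h1, theta_of_lt h2, theta_of_gt h2,
            theta_of_lt h3, theta_of_gt h3, pow_zero, pow_one]
           ring)

theorem hecke_poly' (p : 𝔽) (i j k : ι) (hik : i ≠ k) : (p ^ theta i k - 1) * (p ^ theta j i - 1)
    + p ^ theta k i * (p ^ theta j k - 1) - (p ^ theta j k - 1) * p ^ theta j i = 0 := by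
  exact hecke_poly (ι := ιᵒᵈ) p i j k hik

theorem hecke_ybe {Z : Type*} [AddCommGroup Z] [Module 𝔽 Z] (p : 𝔽) (f : ι → ι → ι → Z) (i k m : ι) :
    (p ^ theta k m - 1) • ((p ^ theta i k - 1) • ((p ^ theta k m - 1) • f i k m -
      p ^ theta m k • f i m k) - p ^ theta k i • ((p ^ theta i m - 1) • f k i m -
      p ^ theta m i • f k m i)) -
    p ^ theta m k • ((p ^ theta i m - 1) • ((p ^ theta m k - 1) • f i m k -
      p ^ theta k m • f i k m) - p ^ theta m i • ((p ^ theta i k - 1) • f m i k -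
      p ^ theta k i • f m k i)) =
    (p ^ theta i k - 1) • ((p ^ theta k m - 1) • ((p ^ theta i k - 1) • f i k m -
      p ^ theta k i • f k i m) - p ^ theta m k • ((p ^ theta i m - 1) • f i m k -
      p ^ theta m i • f m i k)) -
    p ^ theta k i • ((p ^ theta i m - 1) • ((p ^ theta k i - 1) • f k i m -
      p ^ theta i k • f i k m) - p ^ theta m i • ((p ^ theta k m - 1) • f k m i -
      p ^ theta m k • f m k i)) := by
  by_cases e1 : i = k <;> by_cases e2 : k = m <;> by_cases e3 : i = m <;>
    (try subst e1) <;> (try subst e2) <;> (try subst e3) <;> (try contradiction)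
  · simp only [theta_self, pow_zero]
  · rcases lt_or_gt_of_ne e2 with h | h <;>
      simp only [theta_self, theta_of_lt h, theta_of_gt h, pow_zero, pow_one] <;> module
  · rcases lt_or_gt_of_ne e1 with h | h <;>
      simp only [theta_self, theta_of_lt h, theta_of_gt h, pow_zero, pow_one] <;> module
  · rcases lt_or_gt_of_ne e1 with h | h <;>
      simp only [theta_self, theta_of_lt h, theta_of_gt h, pow_zero, pow_one] <;> module
  · rcases lt_or_gt_of_ne e1 with h1 | h1 <;> rcases lt_or_gt_of_ne e2 with h2 | h2 <;>
      rcases lt_or_gt_of_ne e3 with h3 | h3 <;>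
      first
      | exact absurd (h1.trans h2) h3.not_gt
      | exact absurd (h2.trans h1) h3.not_gt
      | (simp only [theta_of_lt h1, theta_of_gt h1, theta_of_lt h2, theta_of_gt h2,
          theta_of_lt h3, theta_of_gt h3, pow_zero, pow_one]
         module)

theorem ι_mul_swap (v w : V) : (ExteriorAlgebra.ι 𝔽 v : ExteriorAlgebra 𝔽 V) * ExteriorAlgebra.ι 𝔽 w =
    -(ExteriorAlgebra.ι 𝔽 w * ExteriorAlgebra.ι 𝔽 v) :=
  eq_neg_of_add_eq_zero_left (ExteriorAlgebra.ι_add_mul_swap v w)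

theorem crossStep_sq (b : Module.Basis ι 𝔽 V) (p : 𝔽) (v : V) :
    crossStep b p v * crossStep b p v = 0 := by
  have swap : ∀ i j (x : ExteriorAlgebra 𝔽 V ⊗[𝔽] V), leftMul (ExteriorAlgebra.ι 𝔽 (b i))
      (leftMul (ExteriorAlgebra.ι 𝔽 (b j)) x) = - leftMul (ExteriorAlgebra.ι 𝔽 (b j))
      (leftMul (ExteriorAlgebra.ι 𝔽 (b i)) x) := by
    intro i j x
    induction x using TensorProduct.induction_on with
    | zero => simp
    | tmul x v => simp [← mul_assoc, ι_mul_swap (b i) (b j), TensorProduct.neg_tmul]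
    | add x y hx hy => simp only [map_add, hx, hy, neg_add]
  have sq : ∀ i (x : ExteriorAlgebra 𝔽 V ⊗[𝔽] V), leftMul (ExteriorAlgebra.ι 𝔽 (b i))
      (leftMul (ExteriorAlgebra.ι 𝔽 (b i)) x) = 0 := by
    intro i x
    induction x using TensorProduct.induction_on with
    | zero => simp
    | tmul x v => simp [← mul_assoc]
    | add x y hx hy => simp only [map_add, hx, hy, add_zero]
  refine sq_zero_of_basis (A := Module.End 𝔽 (V →ₗ[𝔽] ExteriorAlgebra 𝔽 V ⊗[𝔽] V)) b (crossStep b p) (fun i j => ?_) (fun i => ?_) v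
  · ext g : 1
    refine b.ext fun k => ?_
    simp only [LinearMap.add_apply, Module.End.mul_apply, crossStep_basis, map_sub, map_smul,
      LinearMap.zero_apply]
    rw [swap j i, swap k i, swap k j]
    have A' : ((p ^ theta k i - 1) * (p ^ theta i j - 1)
      + p ^ theta i k * (p ^ theta k j - 1) - (p ^ theta k j - 1) * p ^ theta i j) •
      leftMul (ExteriorAlgebra.ι 𝔽 (b i)) (leftMul (ExteriorAlgebra.ι 𝔽 (b k)) (g (b j))) = 0 := by
      by_cases hik : i = k
      · subst hik; rw [sq, smul_zero]
      · rw [hecke_poly p i j k hik, zero_smul]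
    have B' : ((p ^ theta k j - 1) * (p ^ theta j i - 1)
      + p ^ theta j k * (p ^ theta k i - 1) - (p ^ theta k i - 1) * p ^ theta j i) •
      leftMul (ExteriorAlgebra.ι 𝔽 (b j)) (leftMul (ExteriorAlgebra.ι 𝔽 (b k)) (g (b i))) = 0 := by
      by_cases hik : j = k
      · subst hik; rw [sq, smul_zero]
      · rw [hecke_poly p j i k hik, zero_smul]
    linear_combination (norm := module) -A' - B'
  · ext g : 1
    refine b.ext fun k => ?_
    simp only [Module.End.mul_apply, crossStep_basis, map_sub, map_smul,
      LinearMap.zero_apply, sq]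
    rw [swap k i]
    unfold theta
    split_ifs <;> first | (exfalso; order) | simp


/-- The map `x ↦ (v ↦ τ̂(v ⊗ x))`, for `v` in `V`. -/
def genBraid (b : Module.Basis ι 𝔽 V) (p : 𝔽) : ExteriorAlgebra 𝔽 V →ₗ[𝔽] V →ₗ[𝔽] ExteriorAlgebra 𝔽 V ⊗[𝔽] V :=
  LinearMap.applyₗ (TensorProduct.mk 𝔽 (ExteriorAlgebra 𝔽 V) V 1) ∘ₗ
    (ExteriorAlgebra.lift 𝔽 ⟨crossStep b p, crossStep_sq b p⟩).toLinearMap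

theorem genBraid_one (b : Module.Basis ι 𝔽 V) (p : 𝔽) (v : V) :
    genBraid b p 1 v = 1 ⊗ₜ[𝔽] v := by
  simp [genBraid]

theorem genBraid_mul (b : Module.Basis ι 𝔽 V) (p : 𝔽) (w : V) (x : ExteriorAlgebra 𝔽 V) :
    genBraid b p (ExteriorAlgebra.ι 𝔽 w * x) = crossStep b p w (genBraid b p x) := by
  simp only [genBraid, LinearMap.comp_apply, AlgHom.toLinearMap_apply, map_mul,
    ExteriorAlgebra.lift_ι_apply]
  rfl

theorem genBraid_basis_mul (b : Module.Basis ι 𝔽 V) (p : 𝔽) (i k : ι) (x : ExteriorAlgebra 𝔽 V) :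
    genBraid b p (ExteriorAlgebra.ι 𝔽 (b k) * x) (b i) =
      (p ^ theta i k - 1) • leftMul (ExteriorAlgebra.ι 𝔽 (b i)) (genBraid b p x (b k)) -
        p ^ theta k i • leftMul (ExteriorAlgebra.ι 𝔽 (b k)) (genBraid b p x (b i)) := by
  rw [genBraid_mul, crossStep_basis]

theorem induction_left {P : ExteriorAlgebra 𝔽 V → Prop} (b : Module.Basis ι 𝔽 V) (h1 : P 1)
    (hadd : ∀ x y, P x → P y → P (x + y)) (hsmul : ∀ (c : 𝔽) x, P x → P (c • x))
    (hmul : ∀ i x, P x → P (ExteriorAlgebra.ι 𝔽 (b i) * x)) (x : ExteriorAlgebra 𝔽 V) : P x := by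
  suffices h : ∀ z, P z → P (x * z) by simpa using h 1 h1
  induction x using ExteriorAlgebra.induction with
  | algebraMap r =>
    intro z hz
    rw [← Algebra.smul_def]
    exact hsmul r z hz
  | ι v =>
    intro z hz
    have hv : v ∈ Submodule.span 𝔽 (Set.range b) := by simp [b.span_eq]
    induction hv using Submodule.span_induction with
    | mem u hu => obtain ⟨i, rfl⟩ := hu; exact hmul i z hz
    | zero => simpa using hsmul 0 1 h1
    | add u w _ _ hu hw => rw [map_add, add_mul]; exact hadd _ _ hu hw
    | smul c u _ hu => rw [map_smul, smul_mul_assoc]; exact hsmul _ _ hu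
  | mul x y hx hy =>
    intro z hz
    rw [mul_assoc]
    exact hx _ (hy z hz)
  | add x y hx hy =>
    intro z hz
    rw [add_mul]
    exact hadd _ _ (hx z hz) (hy z hz)

/-- `(u ⊗ v) ⊗ y ↦ u ⊗ v y` as a map of `u ⊗ v` and `y`. -/
def absorb : ExteriorAlgebra 𝔽 V ⊗[𝔽] V →ₗ[𝔽] ExteriorAlgebra 𝔽 V →ₗ[𝔽] ExteriorAlgebra 𝔽 V ⊗[𝔽] ExteriorAlgebra 𝔽 V :=
  TensorProduct.lift ((LinearMap.llcomp 𝔽 (ExteriorAlgebra 𝔽 V) (ExteriorAlgebra 𝔽 V) (ExteriorAlgebra 𝔽 V ⊗[𝔽] ExteriorAlgebra 𝔽 V)).compl₁₂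
    (TensorProduct.mk 𝔽 (ExteriorAlgebra 𝔽 V) (ExteriorAlgebra 𝔽 V)) (LinearMap.mul 𝔽 (ExteriorAlgebra 𝔽 V) ∘ₗ ExteriorAlgebra.ι 𝔽))

@[simp] theorem absorb_tmul (u y : ExteriorAlgebra 𝔽 V) (v : V) :
    absorb (u ⊗ₜ[𝔽] v) y = u ⊗ₜ[𝔽] (ExteriorAlgebra.ι 𝔽 v * y) := rfl

/-- Left multiplication by `1 ⊗ v` in the braided tensor square:
`(1 ⊗ v)(x ⊗ y) = (id ⊗ ∇)(τ̂(v ⊗ x) ⊗ y)`. -/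
def rightGen (b : Module.Basis ι 𝔽 V) (p : 𝔽) :
    V →ₗ[𝔽] Module.End 𝔽 (ExteriorAlgebra 𝔽 V ⊗[𝔽] ExteriorAlgebra 𝔽 V) :=
  TensorProduct.lift.equiv (RingHom.id 𝔽) (ExteriorAlgebra 𝔽 V) (ExteriorAlgebra 𝔽 V) (ExteriorAlgebra 𝔽 V ⊗[𝔽] ExteriorAlgebra 𝔽 V) ∘ₗ
    LinearMap.llcomp 𝔽 (ExteriorAlgebra 𝔽 V) (ExteriorAlgebra 𝔽 V ⊗[𝔽] V) (ExteriorAlgebra 𝔽 V →ₗ[𝔽] ExteriorAlgebra 𝔽 V ⊗[𝔽] ExteriorAlgebra 𝔽 V) absorb ∘ₗ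
      (genBraid b p).flip

@[simp] theorem rightGen_tmul (b : Module.Basis ι 𝔽 V) (p : 𝔽) (v : V) (x y : ExteriorAlgebra 𝔽 V) :
    rightGen b p v (x ⊗ₜ[𝔽] y) = absorb (genBraid b p x v) y := by
  simp [rightGen]

/-- Left multiplication by `v ⊗ 1` in the braided tensor square. -/
def leftGen : V →ₗ[𝔽] Module.End 𝔽 (ExteriorAlgebra 𝔽 V ⊗[𝔽] ExteriorAlgebra 𝔽 V) :=
  LinearMap.rTensorHom (ExteriorAlgebra 𝔽 V) ∘ₗ LinearMap.mul 𝔽 (ExteriorAlgebra 𝔽 V) ∘ₗ ExteriorAlgebra.ι 𝔽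

@[simp] theorem leftGen_tmul (v : V) (x y : ExteriorAlgebra 𝔽 V) :
    leftGen v (x ⊗ₜ[𝔽] y) = (ExteriorAlgebra.ι 𝔽 v * x) ⊗ₜ[𝔽] y := rfl

theorem absorb_leftMul (v : V) (z : ExteriorAlgebra 𝔽 V ⊗[𝔽] V) (y : ExteriorAlgebra 𝔽 V) :
    absorb (leftMul (ExteriorAlgebra.ι 𝔽 v) z) y = leftGen v (absorb z y) := by
  induction z using TensorProduct.induction_on with
  | zero => simp
  | tmul u w => simp
  | add z z' h h' => simp only [map_add, LinearMap.add_apply, h, h']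

theorem rightGen_leftGen (b : Module.Basis ι 𝔽 V) (p : 𝔽) (i k : ι)
    (z : ExteriorAlgebra 𝔽 V ⊗[𝔽] ExteriorAlgebra 𝔽 V) :
    rightGen b p (b i) (leftGen (b k) z) =
      (p ^ theta i k - 1) • leftGen (b i) (rightGen b p (b k) z) -
        p ^ theta k i • leftGen (b k) (rightGen b p (b i) z) := by
  induction z using TensorProduct.induction_on with
  | zero => simp
  | tmul x y =>
    simp only [leftGen_tmul, rightGen_tmul, genBraid_basis_mul, map_sub, map_smul,
      LinearMap.sub_apply, LinearMap.smul_apply, absorb_leftMul]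
  | add z z' h h' => simp only [map_add, h, h', smul_add]; abel

/-- Operators `Q i` which move past the operators `L k` by the Hecke rule anticommute and square
to zero on `L k z` as soon as they do on `z`. -/
theorem anticomm_step {Z : Type*} [AddCommGroup Z] [Module 𝔽 Z] (p : 𝔽) (L Q : ι → Z →ₗ[𝔽] Z)
    (h : ∀ i k z, Q i (L k z) = (p ^ theta i k - 1) • L i (Q k z) - p ^ theta k i • L k (Q i z))
    (z : Z) (hz : ∀ i j, Q i (Q j z) + Q j (Q i z) = 0) (hz' : ∀ i, Q i (Q i z) = 0) (k : ι) :
    (∀ i j, Q i (Q j (L k z)) + Q j (Q i (L k z)) = 0) ∧ ∀ i, Q i (Q i (L k z)) = 0 := by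
  have sw : ∀ i j, Q i (Q j z) = -Q j (Q i z) := fun i j => eq_neg_of_add_eq_zero_left (hz i j)
  constructor
  · intro i j
    have A : ((p ^ theta j k - 1) * (p ^ theta i j - 1) + p ^ theta k j * (p ^ theta i k - 1)
      - (p ^ theta i k - 1) * p ^ theta i j) • L i (Q j (Q k z)) = 0 := by
      by_cases hjk : j = k
      · subst hjk; rw [hz', map_zero, smul_zero]
      · rw [hecke_poly' p j i k hjk, zero_smul]
    have B : ((p ^ theta i k - 1) * (p ^ theta j i - 1) + p ^ theta k i * (p ^ theta j k - 1)
      - (p ^ theta j k - 1) * p ^ theta j i) • L j (Q i (Q k z)) = 0 := by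
      by_cases hik : i = k
      · subst hik; rw [hz', map_zero, smul_zero]
      · rw [hecke_poly' p i j k hik, zero_smul]
    simp only [h, map_sub, map_smul]
    rw [sw k j, sw k i, sw j i]
    simp only [map_neg]
    linear_combination (norm := module) A + B
  · intro i
    simp only [h, map_sub, map_smul, hz']
    rw [sw k i, map_neg]
    unfold theta
    split_ifs <;> first | (exfalso; order) | simp

theorem rightGen_sq (b : Module.Basis ι 𝔽 V) (p : 𝔽) (v : V) :
    rightGen b p v * rightGen b p v = 0 := by
  have key : ∀ z, (∀ i j, rightGen b p (b i) (rightGen b p (b j) z) +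
      rightGen b p (b j) (rightGen b p (b i) z) = 0) ∧
      ∀ i, rightGen b p (b i) (rightGen b p (b i) z) = 0 := by
    intro z
    induction z using TensorProduct.induction_on with
    | zero => simp
    | tmul x y =>
      induction x using induction_left b with
      | h1 =>
        simp [genBraid_one, ← mul_assoc, ← TensorProduct.tmul_add, ← add_mul,
          ExteriorAlgebra.ι_add_mul_swap]
      | hadd x x' h h' =>
        refine ⟨fun i j => ?_, fun i => ?_⟩
        · simp only [TensorProduct.add_tmul, map_add]
          linear_combination (norm := module) h.1 i j + h'.1 i j
        · simp only [TensorProduct.add_tmul, map_add, h.2, h'.2, add_zero]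
      | hsmul c x h =>
        refine ⟨fun i j => ?_, fun i => ?_⟩
        · simp only [← TensorProduct.smul_tmul', map_smul, ← smul_add, h.1, smul_zero]
        · simp only [← TensorProduct.smul_tmul', map_smul, h.2, smul_zero]
      | hmul k x h =>
        exact anticomm_step p (fun i => leftGen (b i)) (fun i => rightGen b p (b i))
          (rightGen_leftGen b p) (x ⊗ₜ[𝔽] y) h.1 h.2 k
    | add z z' h h' =>
      refine ⟨fun i j => ?_, fun i => ?_⟩
      · simp only [map_add]
        linear_combination (norm := module) h.1 i j + h'.1 i j
      · simp only [map_add, h.2, h'.2, add_zero]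
  exact sq_zero_of_basis (A := Module.End 𝔽 (ExteriorAlgebra 𝔽 V ⊗[𝔽] ExteriorAlgebra 𝔽 V)) b (rightGen b p)
    (fun i j => LinearMap.ext fun z => (key z).1 i j)
    (fun i => LinearMap.ext fun z => (key z).2 i) v

/-- The braiding `τ̂` on the exterior algebra induced by `τ`: `τ̂(1 ⊗ y) = y ⊗ 1` and
`τ̂(v x ⊗ y) = (id ⊗ ∇)(τ̂ ⊗ id)(v ⊗ τ̂(x ⊗ y))`. -/
def braid (b : Module.Basis ι 𝔽 V) (p : 𝔽) :
    ExteriorAlgebra 𝔽 V ⊗[𝔽] ExteriorAlgebra 𝔽 V →ₗ[𝔽] ExteriorAlgebra 𝔽 V ⊗[𝔽] ExteriorAlgebra 𝔽 V :=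
  TensorProduct.lift
    ((ExteriorAlgebra.lift 𝔽 ⟨rightGen b p, rightGen_sq b p⟩).toLinearMap.compl₂
      ((TensorProduct.mk 𝔽 (ExteriorAlgebra 𝔽 V) (ExteriorAlgebra 𝔽 V)).flip 1))

theorem braid_one_tmul (b : Module.Basis ι 𝔽 V) (p : 𝔽) (y : ExteriorAlgebra 𝔽 V) :
    braid b p (1 ⊗ₜ[𝔽] y) = y ⊗ₜ[𝔽] 1 := by
  simp [braid]

theorem braid_ι_mul (b : Module.Basis ι 𝔽 V) (p : 𝔽) (v : V) (x y : ExteriorAlgebra 𝔽 V) :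
    braid b p ((ExteriorAlgebra.ι 𝔽 v * x) ⊗ₜ[𝔽] y) =
      rightGen b p v (braid b p (x ⊗ₜ[𝔽] y)) := by
  simp [braid]

/-- Left multiplication by `v ⊗ 1 + 1 ⊗ v` in the braided tensor square. -/
def comulGen (b : Module.Basis ι 𝔽 V) (p : 𝔽) :
    V →ₗ[𝔽] Module.End 𝔽 (ExteriorAlgebra 𝔽 V ⊗[𝔽] ExteriorAlgebra 𝔽 V) :=
  leftGen + rightGen b p

theorem comulGen_apply (b : Module.Basis ι 𝔽 V) (p : 𝔽) (v : V) (z : ExteriorAlgebra 𝔽 V ⊗[𝔽] ExteriorAlgebra 𝔽 V) :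
    comulGen b p v z = leftGen v z + rightGen b p v z := rfl

theorem comulGen_sq (b : Module.Basis ι 𝔽 V) (p : 𝔽) (v : V) :
    comulGen b p v * comulGen b p v = 0 := by
  have swap : ∀ i j (z : ExteriorAlgebra 𝔽 V ⊗[𝔽] ExteriorAlgebra 𝔽 V), leftGen (b i) (leftGen (b j) z) =
      - leftGen (b j) (leftGen (b i) z) := by
    intro i j z
    induction z using TensorProduct.induction_on with
    | zero => simp
    | tmul x v => simp [← mul_assoc, ι_mul_swap (b i) (b j), TensorProduct.neg_tmul]
    | add x y hx hy => simp only [map_add, hx, hy, neg_add]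
  have sq : ∀ i (z : ExteriorAlgebra 𝔽 V ⊗[𝔽] ExteriorAlgebra 𝔽 V), leftGen (b i) (leftGen (b i) z) = 0 := by
    intro i z
    induction z using TensorProduct.induction_on with
    | zero => simp
    | tmul x v => simp [← mul_assoc]
    | add x y hx hy => simp only [map_add, hx, hy, add_zero]
  have rsq : ∀ v z, rightGen b p v (rightGen b p v z) = 0 :=
    fun v z => congr($(rightGen_sq b p v) z)
  have rswap : ∀ i j z, rightGen b p (b i) (rightGen b p (b j) z) =
      - rightGen b p (b j) (rightGen b p (b i) z) := by
    intro i j z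
    have := rsq (b i + b j) z
    simp only [map_add, LinearMap.add_apply, rsq, zero_add, add_zero] at this
    exact eq_neg_of_add_eq_zero_right this
  refine sq_zero_of_basis (A := Module.End 𝔽 (ExteriorAlgebra 𝔽 V ⊗[𝔽] ExteriorAlgebra 𝔽 V)) b
    (comulGen b p) (fun i j => LinearMap.ext fun z => ?_)
    (fun i => LinearMap.ext fun z => ?_) v
  · simp only [comulGen_apply, LinearMap.add_apply, Module.End.mul_apply, map_add,
      rightGen_leftGen, LinearMap.zero_apply]
    rw [swap i j, rswap i j]
    module
  · simp only [comulGen_apply, Module.End.mul_apply, map_add,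
      rightGen_leftGen, LinearMap.zero_apply, sq, rsq]
    simp [theta]

/-- The coproduct `Δ`, with `Δ(1) = 1 ⊗ 1` and `Δ(v x) = (v ⊗ 1 + 1 ⊗ v) Δ(x)` in the braided
tensor square. -/
def comul (b : Module.Basis ι 𝔽 V) (p : 𝔽) : ExteriorAlgebra 𝔽 V →ₗ[𝔽] ExteriorAlgebra 𝔽 V ⊗[𝔽] ExteriorAlgebra 𝔽 V :=
  LinearMap.applyₗ (1 ⊗ₜ[𝔽] 1) ∘ₗ
    (ExteriorAlgebra.lift 𝔽 ⟨comulGen b p, comulGen_sq b p⟩).toLinearMap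

theorem comul_one (b : Module.Basis ι 𝔽 V) (p : 𝔽) : comul b p 1 = 1 ⊗ₜ[𝔽] 1 := by
  simp [comul]

theorem comul_ι_mul (b : Module.Basis ι 𝔽 V) (p : 𝔽) (v : V) (x : ExteriorAlgebra 𝔽 V) :
    comul b p (ExteriorAlgebra.ι 𝔽 v * x) =
      leftGen v (comul b p x) + rightGen b p v (comul b p x) := by
  simp only [comul, LinearMap.comp_apply, AlgHom.toLinearMap_apply, map_mul,
    ExteriorAlgebra.lift_ι_apply]
  rfl

/-- The map `x ↦ ∇τ̂(S(v) ⊗ x)`, with `S(v) = -v`. -/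
def antipodeGen (b : Module.Basis ι 𝔽 V) (p : 𝔽) : V →ₗ[𝔽] Module.End 𝔽 (ExteriorAlgebra 𝔽 V) :=
  -(LinearMap.llcomp 𝔽 (ExteriorAlgebra 𝔽 V) (ExteriorAlgebra 𝔽 V ⊗[𝔽] V) (ExteriorAlgebra 𝔽 V) (TensorProduct.lift
    ((LinearMap.mul 𝔽 (ExteriorAlgebra 𝔽 V)).compl₂ (ExteriorAlgebra.ι 𝔽))) ∘ₗ (genBraid b p).flip)

theorem antipodeGen_apply (b : Module.Basis ι 𝔽 V) (p : 𝔽) (v : V) (x : ExteriorAlgebra 𝔽 V) :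
    antipodeGen b p v x = -TensorProduct.lift
    ((LinearMap.mul 𝔽 (ExteriorAlgebra 𝔽 V)).compl₂ (ExteriorAlgebra.ι 𝔽)) (genBraid b p x v) := rfl

theorem antipodeGen_mul (b : Module.Basis ι 𝔽 V) (p : 𝔽) (i k : ι) (x : ExteriorAlgebra 𝔽 V) :
    antipodeGen b p (b i) (ExteriorAlgebra.ι 𝔽 (b k) * x) =
      (p ^ theta i k - 1) • (ExteriorAlgebra.ι 𝔽 (b i) * antipodeGen b p (b k) x) -
        p ^ theta k i • (ExteriorAlgebra.ι 𝔽 (b k) * antipodeGen b p (b i) x) := by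
  have h : ∀ (v : V) (z : ExteriorAlgebra 𝔽 V ⊗[𝔽] V), TensorProduct.lift
      ((LinearMap.mul 𝔽 (ExteriorAlgebra 𝔽 V)).compl₂ (ExteriorAlgebra.ι 𝔽))
      (leftMul (ExteriorAlgebra.ι 𝔽 v) z) = ExteriorAlgebra.ι 𝔽 v * TensorProduct.lift
      ((LinearMap.mul 𝔽 (ExteriorAlgebra 𝔽 V)).compl₂ (ExteriorAlgebra.ι 𝔽)) z := by
    intro v z
    induction z using TensorProduct.induction_on with
    | zero => simp
    | tmul u w => simp [mul_assoc]
    | add z z' h h' => simp only [map_add, h, h', mul_add]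
  simp only [antipodeGen_apply, genBraid_basis_mul, map_sub, map_smul, h, mul_neg]
  module

theorem antipodeGen_sq (b : Module.Basis ι 𝔽 V) (p : 𝔽) (v : V) :
    antipodeGen b p v * antipodeGen b p v = 0 := by
  have one : ∀ v, antipodeGen b p v 1 = -ExteriorAlgebra.ι 𝔽 v := by
    intro v; simp [antipodeGen_apply, genBraid_one]
  have one' : ∀ i k, antipodeGen b p (b i) (ExteriorAlgebra.ι 𝔽 (b k)) =
      (p ^ theta i k - 1) • (ExteriorAlgebra.ι 𝔽 (b i) * -ExteriorAlgebra.ι 𝔽 (b k)) -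
        p ^ theta k i • (ExteriorAlgebra.ι 𝔽 (b k) * -ExteriorAlgebra.ι 𝔽 (b i)) := by
    intro i k
    have := antipodeGen_mul b p i k 1
    rwa [mul_one, one, one] at this
  have key : ∀ x, (∀ i j, antipodeGen b p (b i) (antipodeGen b p (b j) x) +
      antipodeGen b p (b j) (antipodeGen b p (b i) x) = 0) ∧
      ∀ i, antipodeGen b p (b i) (antipodeGen b p (b i) x) = 0 := by
    intro x
    induction x using induction_left b with
    | h1 =>
      refine ⟨fun i j => ?_, fun i => ?_⟩
      · rw [one, one, map_neg, map_neg, one', one', mul_neg, mul_neg, ι_mul_swap (b i) (b j)]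
        module
      · rw [one, map_neg, one']
        simp
    | hadd x x' h h' =>
      refine ⟨fun i j => ?_, fun i => ?_⟩
      · simp only [map_add]
        linear_combination (norm := module) h.1 i j + h'.1 i j
      · simp only [map_add, h.2, h'.2, add_zero]
    | hsmul c x h =>
      refine ⟨fun i j => ?_, fun i => ?_⟩
      · simp only [map_smul, ← smul_add, h.1, smul_zero]
      · simp only [map_smul, h.2, smul_zero]
    | hmul k x h =>
      exact anticomm_step p (fun i => LinearMap.mulLeft 𝔽 (ExteriorAlgebra.ι 𝔽 (b i)))
        (fun i => antipodeGen b p (b i)) (antipodeGen_mul b p) x h.1 h.2 k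
  exact sq_zero_of_basis (A := Module.End 𝔽 (ExteriorAlgebra 𝔽 V)) b (antipodeGen b p)
    (fun i j => LinearMap.ext fun z => (key z).1 i j)
    (fun i => LinearMap.ext fun z => (key z).2 i) v

/-- The antipode `S`, with `S(1) = 1` and `S(v x) = ∇τ̂(S(v) ⊗ S(x))`, where `S(v) = -v`. -/
def antipode (b : Module.Basis ι 𝔽 V) (p : 𝔽) : ExteriorAlgebra 𝔽 V →ₗ[𝔽] ExteriorAlgebra 𝔽 V :=
  LinearMap.applyₗ 1 ∘ₗ
    (ExteriorAlgebra.lift 𝔽 ⟨antipodeGen b p, antipodeGen_sq b p⟩).toLinearMap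

theorem antipode_one (b : Module.Basis ι 𝔽 V) (p : 𝔽) : antipode b p 1 = 1 := by
  simp [antipode]

theorem antipode_ι_mul (b : Module.Basis ι 𝔽 V) (p : 𝔽) (v : V) (x : ExteriorAlgebra 𝔽 V) :
    antipode b p (ExteriorAlgebra.ι 𝔽 v * x) = antipodeGen b p v (antipode b p x) := by
  simp only [antipode, LinearMap.comp_apply, AlgHom.toLinearMap_apply, map_mul,
    ExteriorAlgebra.lift_ι_apply]
  rfl

/-! The rules which determine the three maps. -/

theorem genBraid_mul_general (b : Module.Basis ι 𝔽 V) (p : 𝔽) (a u : ExteriorAlgebra 𝔽 V) (v : V) :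
    genBraid b p (a * u) v =
      TensorProduct.lift (leftMul.compl₂ (genBraid b p u)) (genBraid b p a v) := by
  have hl : ∀ (w : V) (z : ExteriorAlgebra 𝔽 V ⊗[𝔽] V),
      TensorProduct.lift (leftMul.compl₂ (genBraid b p u)) (leftMul (ExteriorAlgebra.ι 𝔽 w) z) =
      leftMul (ExteriorAlgebra.ι 𝔽 w)
        (TensorProduct.lift (leftMul.compl₂ (genBraid b p u)) z) := by
    intro w z
    induction z using TensorProduct.induction_on with
    | zero => simp
    | tmul y w' =>
      simp only [leftMul_tmul, TensorProduct.lift.tmul, LinearMap.compl₂_apply]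
      induction genBraid b p u w' using TensorProduct.induction_on with
      | zero => simp
      | tmul y' w'' => simp [mul_assoc]
      | add z z' h h' => simp only [map_add, h, h']
    | add z z' h h' => simp only [map_add, h, h']
  suffices h : genBraid b p (a * u) =
      TensorProduct.lift (leftMul.compl₂ (genBraid b p u)) ∘ₗ genBraid b p a from
    congr($h v)
  refine b.ext fun i => ?_
  simp only [LinearMap.comp_apply]
  induction a using induction_left b generalizing i with
  | h1 =>
    rw [one_mul, genBraid_one, TensorProduct.lift.tmul, LinearMap.compl₂_apply]
    induction genBraid b p u (b i) using TensorProduct.induction_on with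
    | zero => simp
    | tmul y w => simp
    | add z z' h h' => rw [map_add, ← h, ← h']
  | hadd x y hx hy => simp only [add_mul, map_add, LinearMap.add_apply, hx, hy]
  | hsmul c x hx => simp only [smul_mul_assoc, map_smul, LinearMap.smul_apply, hx]
  | hmul k x hx =>
    rw [mul_assoc, genBraid_basis_mul, genBraid_basis_mul, hx, hx, map_sub, map_smul, map_smul,
      hl, hl]

/-- Left multiplication by `1 ⊗ x` in the braided tensor square. -/
def rightMul (b : Module.Basis ι 𝔽 V) (p : 𝔽) :
    ExteriorAlgebra 𝔽 V →ₐ[𝔽] Module.End 𝔽 (ExteriorAlgebra 𝔽 V ⊗[𝔽] ExteriorAlgebra 𝔽 V) :=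
  ExteriorAlgebra.lift 𝔽 ⟨rightGen b p, rightGen_sq b p⟩

theorem rightMul_ι_mul (b : Module.Basis ι 𝔽 V) (p : 𝔽) (v : V) (x : ExteriorAlgebra 𝔽 V) :
    rightMul b p (ExteriorAlgebra.ι 𝔽 v * x) = rightGen b p v * rightMul b p x := by
  simp [rightMul]

theorem braid_tmul (b : Module.Basis ι 𝔽 V) (p : 𝔽) (x y : ExteriorAlgebra 𝔽 V) :
    braid b p (x ⊗ₜ[𝔽] y) = rightMul b p x (y ⊗ₜ[𝔽] 1) := rfl

/-- `id ⊗ ∇`. -/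
def mulR : ExteriorAlgebra 𝔽 V ⊗[𝔽] ExteriorAlgebra 𝔽 V →ₗ[𝔽] ExteriorAlgebra 𝔽 V →ₗ[𝔽] ExteriorAlgebra 𝔽 V ⊗[𝔽] ExteriorAlgebra 𝔽 V :=
  (LinearMap.lTensorHom (ExteriorAlgebra 𝔽 V) ∘ₗ (LinearMap.mul 𝔽 (ExteriorAlgebra 𝔽 V)).flip).flip

@[simp] theorem mulR_tmul (x y z : ExteriorAlgebra 𝔽 V) : mulR (x ⊗ₜ[𝔽] y) z = x ⊗ₜ[𝔽] (y * z) := rfl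

/-- `∇ ⊗ id`. -/
def mulL : ExteriorAlgebra 𝔽 V →ₗ[𝔽] ExteriorAlgebra 𝔽 V ⊗[𝔽] ExteriorAlgebra 𝔽 V →ₗ[𝔽] ExteriorAlgebra 𝔽 V ⊗[𝔽] ExteriorAlgebra 𝔽 V :=
  LinearMap.rTensorHom (ExteriorAlgebra 𝔽 V) ∘ₗ LinearMap.mul 𝔽 (ExteriorAlgebra 𝔽 V)

@[simp] theorem mulL_tmul (x y z : ExteriorAlgebra 𝔽 V) : mulL x (y ⊗ₜ[𝔽] z) = (x * y) ⊗ₜ[𝔽] z := rfl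

theorem rightGen_mulR (b : Module.Basis ι 𝔽 V) (p : 𝔽) (v : V) (z : ExteriorAlgebra 𝔽 V ⊗[𝔽] ExteriorAlgebra 𝔽 V)
    (y : ExteriorAlgebra 𝔽 V) : rightGen b p v (mulR z y) = mulR (rightGen b p v z) y := by
  induction z using TensorProduct.induction_on with
  | zero => simp
  | tmul u w =>
    simp only [mulR_tmul, rightGen_tmul]
    induction genBraid b p u v using TensorProduct.induction_on with
    | zero => simp
    | tmul a c => simp [mul_assoc]
    | add z z' h h' => simp only [map_add, LinearMap.add_apply, h, h']
  | add z z' h h' => simp only [map_add, LinearMap.add_apply, h, h']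

theorem rightMul_mulR (b : Module.Basis ι 𝔽 V) (p : 𝔽) (x : ExteriorAlgebra 𝔽 V)
    (z : ExteriorAlgebra 𝔽 V ⊗[𝔽] ExteriorAlgebra 𝔽 V) (y : ExteriorAlgebra 𝔽 V) :
    rightMul b p x (mulR z y) = mulR (rightMul b p x z) y := by
  induction x using induction_left b with
  | h1 => simp
  | hadd x y hx hy => simp only [map_add, LinearMap.add_apply, hx, hy]
  | hsmul c x hx => simp only [map_smul, LinearMap.smul_apply, hx]
  | hmul k x hx =>
    rw [rightMul_ι_mul, Module.End.mul_apply, hx, rightGen_mulR, Module.End.mul_apply]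

theorem rightMul_tmul (b : Module.Basis ι 𝔽 V) (p : 𝔽) (x u w : ExteriorAlgebra 𝔽 V) :
    rightMul b p x (u ⊗ₜ[𝔽] w) = mulR (braid b p (x ⊗ₜ[𝔽] u)) w := by
  rw [braid_tmul, ← rightMul_mulR, mulR_tmul, one_mul]

theorem rightGen_mulL (b : Module.Basis ι 𝔽 V) (p : 𝔽) (v : V) (a : ExteriorAlgebra 𝔽 V)
    (z : ExteriorAlgebra 𝔽 V ⊗[𝔽] ExteriorAlgebra 𝔽 V) :
    rightGen b p v (mulL a z) =
      TensorProduct.lift (mulL.compl₂ ((rightGen b p).flip z)) (genBraid b p a v) := by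
  induction z using TensorProduct.induction_on with
  | zero =>
    rw [map_zero, map_zero]
    induction genBraid b p a v using TensorProduct.induction_on with
    | zero => simp
    | tmul a' v' => simp
    | add y y' h h' => rw [map_add, ← h, ← h', add_zero]
  | tmul u w =>
    rw [mulL_tmul, rightGen_tmul, genBraid_mul_general]
    induction genBraid b p a v using TensorProduct.induction_on with
    | zero => simp
    | tmul a' v' =>
      simp only [TensorProduct.lift.tmul, LinearMap.compl₂_apply, LinearMap.flip_apply,
        rightGen_tmul]
      induction genBraid b p u v' using TensorProduct.induction_on with
      | zero => simp
      | tmul y' w'' => simp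
      | add z z' h h' => simp only [map_add, LinearMap.add_apply, h, h']
    | add z z' h h' => simp only [map_add, LinearMap.add_apply, h, h']
  | add z z' h h' =>
    rw [map_add, map_add, h, h']
    induction genBraid b p a v using TensorProduct.induction_on with
    | zero => simp
    | tmul a' v' => simp
    | add y y' h h' =>
      rw [map_add, map_add, map_add, ← h, ← h']
      abel

/-- The product `(∇ ⊗ ∇)(id ⊗ τ̂ ⊗ id)` of the braided tensor square. -/
def sqMul (b : Module.Basis ι 𝔽 V) (p : 𝔽) :
    (ExteriorAlgebra 𝔽 V ⊗[𝔽] ExteriorAlgebra 𝔽 V) →ₗ[𝔽] Module.End 𝔽 (ExteriorAlgebra 𝔽 V ⊗[𝔽] ExteriorAlgebra 𝔽 V) :=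
  TensorProduct.lift ((LinearMap.mul 𝔽 (Module.End 𝔽 (ExteriorAlgebra 𝔽 V ⊗[𝔽] ExteriorAlgebra 𝔽 V))).compl₁₂
    mulL (rightMul b p).toLinearMap)

theorem sqMul_tmul (b : Module.Basis ι 𝔽 V) (p : 𝔽) (x y u w : ExteriorAlgebra 𝔽 V) :
    sqMul b p (x ⊗ₜ[𝔽] y) (u ⊗ₜ[𝔽] w) = mulL x (mulR (braid b p (y ⊗ₜ[𝔽] u)) w) := by
  rw [← rightMul_tmul]; rfl

theorem sqMul_rightGen (b : Module.Basis ι 𝔽 V) (p : 𝔽) (v : V) (s t : ExteriorAlgebra 𝔽 V ⊗[𝔽] ExteriorAlgebra 𝔽 V) :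
    sqMul b p (rightGen b p v s) t = rightGen b p v (sqMul b p s t) := by
  induction s using TensorProduct.induction_on with
  | zero => simp
  | tmul a q =>
    change _ = rightGen b p v (mulL a (rightMul b p q t))
    rw [rightGen_mulL, rightGen_tmul]
    induction genBraid b p a v using TensorProduct.induction_on with
    | zero => simp
    | tmul a' v' =>
      change mulL a' (rightMul b p (ExteriorAlgebra.ι 𝔽 v' * q) t) = _
      rw [rightMul_ι_mul]
      rfl
    | add y y' h h' => simp only [map_add, LinearMap.add_apply, h, h']
  | add s s' h h' => simp only [map_add, LinearMap.add_apply, h, h']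

theorem sqMul_leftGen (b : Module.Basis ι 𝔽 V) (p : 𝔽) (v : V) (s t : ExteriorAlgebra 𝔽 V ⊗[𝔽] ExteriorAlgebra 𝔽 V) :
    sqMul b p (leftGen v s) t = leftGen v (sqMul b p s t) := by
  induction s using TensorProduct.induction_on with
  | zero => simp
  | tmul a q =>
    change mulL _ (rightMul b p q t) = leftGen v (mulL a (rightMul b p q t))
    induction rightMul b p q t using TensorProduct.induction_on with
    | zero => simp
    | tmul a' v' => simp [mul_assoc]
    | add y y' h h' => simp only [map_add, h, h']
  | add s s' h h' => simp only [map_add, LinearMap.add_apply, h, h']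

theorem comul_mul_aux (b : Module.Basis ι 𝔽 V) (p : 𝔽) (x y : ExteriorAlgebra 𝔽 V) :
    comul b p (x * y) = sqMul b p (comul b p x) (comul b p y) := by
  induction x using induction_left b with
  | h1 =>
    rw [one_mul, comul_one]
    change _ = mulL 1 (rightMul b p 1 (comul b p y))
    rw [map_one (rightMul b p), Module.End.one_apply]
    induction comul b p y using TensorProduct.induction_on with
    | zero => simp
    | tmul a' v' => simp
    | add y y' h h' => rw [map_add, ← h, ← h']
  | hadd x y hx hy => simp only [add_mul, map_add, LinearMap.add_apply, hx, hy]
  | hsmul c x hx => simp only [smul_mul_assoc, map_smul, LinearMap.smul_apply, hx]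
  | hmul k x hx =>
    rw [mul_assoc, comul_ι_mul, hx, comul_ι_mul, map_add, LinearMap.add_apply, sqMul_rightGen,
      sqMul_leftGen]

/-- The elements of `V` are primitive. -/
theorem comul_ι (b : Module.Basis ι 𝔽 V) (p : 𝔽) (v : V) :
    comul b p (ExteriorAlgebra.ι 𝔽 v) =
      ExteriorAlgebra.ι 𝔽 v ⊗ₜ[𝔽] 1 + 1 ⊗ₜ[𝔽] ExteriorAlgebra.ι 𝔽 v := by
  have := comul_ι_mul b p v 1
  simpa [comul_one, genBraid_one] using this

theorem braid_tmul_one (b : Module.Basis ι 𝔽 V) (p : 𝔽) (x : ExteriorAlgebra 𝔽 V) :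
    braid b p (x ⊗ₜ[𝔽] 1) = 1 ⊗ₜ[𝔽] x := by
  induction x using induction_left b with
  | h1 => exact braid_one_tmul b p 1
  | hadd x y hx hy => rw [TensorProduct.add_tmul, map_add, hx, hy, TensorProduct.tmul_add]
  | hsmul c x hx => rw [← TensorProduct.smul_tmul', map_smul, hx, TensorProduct.tmul_smul]
  | hmul k x hx => rw [braid_ι_mul, hx, rightGen_tmul, genBraid_one, absorb_tmul]

/-- `τ̂` restricts to `τ` on `V ⊗ V`. -/
theorem braid_ι_tmul_ι (b : Module.Basis ι 𝔽 V) (p : 𝔽) (u v : V) :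
    braid b p (ExteriorAlgebra.ι 𝔽 u ⊗ₜ[𝔽] ExteriorAlgebra.ι 𝔽 v) =
      TensorProduct.map (ExteriorAlgebra.ι 𝔽) (ExteriorAlgebra.ι 𝔽) (hecke b p (u ⊗ₜ[𝔽] v)) := by
  suffices h : braid b p ∘ₗ TensorProduct.map (ExteriorAlgebra.ι 𝔽) (ExteriorAlgebra.ι 𝔽) =
      TensorProduct.map (ExteriorAlgebra.ι 𝔽) (ExteriorAlgebra.ι 𝔽) ∘ₗ hecke b p from
    congr($h (u ⊗ₜ[𝔽] v))
  refine (b.tensorProduct b).ext fun ⟨i, j⟩ => ?_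
  have h1 := braid_ι_mul b p (b i) 1 (ExteriorAlgebra.ι 𝔽 (b j))
  have h2 := genBraid_basis_mul b p i j 1
  rw [mul_one] at h1 h2
  simp only [Module.Basis.tensorProduct_apply, LinearMap.comp_apply, TensorProduct.map_tmul, h1,
    hecke_basis, braid_one_tmul, rightGen_tmul, h2, genBraid_one]
  simp

theorem braid_mul_tmul_aux (b : Module.Basis ι 𝔽 V) (p : 𝔽) (x y z : ExteriorAlgebra 𝔽 V) :
    braid b p ((x * y) ⊗ₜ[𝔽] z) =
      TensorProduct.lift (mulR.compl₁₂ (braid b p ∘ₗ TensorProduct.mk 𝔽 _ _ x) LinearMap.id)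
        (braid b p (y ⊗ₜ[𝔽] z)) := by
  rw [braid_tmul, map_mul, Module.End.mul_apply, ← braid_tmul]
  induction braid b p (y ⊗ₜ[𝔽] z) using TensorProduct.induction_on with
  | zero => simp
  | tmul a' v' => simp [rightMul_tmul]
  | add y y' h h' => simp only [map_add, h, h']

theorem braid_tmul_mul_aux (b : Module.Basis ι 𝔽 V) (p : 𝔽) (x y z : ExteriorAlgebra 𝔽 V) :
    braid b p (x ⊗ₜ[𝔽] (y * z)) =
      TensorProduct.lift (mulL.compl₂ (braid b p ∘ₗ (TensorProduct.mk 𝔽 _ _).flip z))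
        (braid b p (x ⊗ₜ[𝔽] y)) := by
  have hs : ∀ s, TensorProduct.lift (mulL.compl₂ (braid b p ∘ₗ (TensorProduct.mk 𝔽 _ _).flip z)) s =
      sqMul b p s (z ⊗ₜ[𝔽] 1) := by
    intro s
    induction s using TensorProduct.induction_on with
    | zero => simp
    | tmul a v => rfl
    | add y y' h h' => simp only [map_add, LinearMap.add_apply, h, h']
  rw [hs]
  induction x using induction_left b with
  | h1 => simp [braid_one_tmul, sqMul_tmul]
  | hadd x y hx hy => simp only [TensorProduct.add_tmul, map_add, LinearMap.add_apply, hx, hy]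
  | hsmul c x hx => simp only [← TensorProduct.smul_tmul', map_smul, LinearMap.smul_apply, hx]
  | hmul k x hx => rw [braid_ι_mul, braid_ι_mul, hx, sqMul_rightGen]


theorem genBraid_antipodeGen (b : Module.Basis ι 𝔽 V) (p : 𝔽) (i k : ι) (u : ExteriorAlgebra 𝔽 V) :
    genBraid b p (antipodeGen b p (b k) u) (b i) =
      (p ^ theta i k - 1) • (antipodeGen b p (b i)).rTensor V (genBraid b p u (b k)) -
        p ^ theta k i • (antipodeGen b p (b k)).rTensor V (genBraid b p u (b i)) := by
  have one : ∀ v, antipodeGen b p v 1 = -ExteriorAlgebra.ι 𝔽 v := by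
    intro v; simp [antipodeGen_apply, genBraid_one]
  have key : ∀ (i k : ι) (z : ExteriorAlgebra 𝔽 V ⊗[𝔽] V), (antipodeGen b p (b i)).rTensor V
      (leftMul (ExteriorAlgebra.ι 𝔽 (b k)) z) =
      (p ^ theta i k - 1) • leftMul (ExteriorAlgebra.ι 𝔽 (b i))
        ((antipodeGen b p (b k)).rTensor V z) -
      p ^ theta k i • leftMul (ExteriorAlgebra.ι 𝔽 (b k))
        ((antipodeGen b p (b i)).rTensor V z) := by
    intro i k z
    induction z using TensorProduct.induction_on with
    | zero => simp
    | tmul x v =>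
      simp only [leftMul_tmul, LinearMap.rTensor_tmul, antipodeGen_mul, TensorProduct.sub_tmul,
        TensorProduct.smul_tmul']
    | add z z' h h' =>
      rw [map_add, map_add, h, h', map_add, map_add, map_add, map_add]
      module
  induction u using induction_left b generalizing i k with
  | h1 =>
    have h := genBraid_basis_mul b p i k 1
    rw [mul_one] at h
    rw [one, map_neg, LinearMap.neg_apply, h]
    simp only [genBraid_one, leftMul_tmul, LinearMap.rTensor_tmul, one, mul_one,
      TensorProduct.neg_tmul]
    module
  | hadd x y hx hy =>
    simp only [map_add, LinearMap.add_apply, hx, hy]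
    module
  | hsmul c x hx =>
    simp only [map_smul, LinearMap.smul_apply, hx]
    module
  | hmul m x hx =>
    simp only [antipodeGen_mul, genBraid_basis_mul, map_sub, map_smul, LinearMap.sub_apply,
      LinearMap.smul_apply, hx, key]
    exact hecke_ybe p (fun i k m => leftMul (ExteriorAlgebra.ι 𝔽 (b i))
      ((antipodeGen b p (b k)).rTensor V (genBraid b p x (b m)))) i k m

theorem genBraid_antipode (b : Module.Basis ι 𝔽 V) (p : 𝔽) (u : ExteriorAlgebra 𝔽 V) (v : V) :
    genBraid b p (antipode b p u) v = (antipode b p).rTensor V (genBraid b p u v) := by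
  suffices h : genBraid b p (antipode b p u) = (antipode b p).rTensor V ∘ₗ genBraid b p u from
    congr($h v)
  have key : ∀ (k : ι) (z : ExteriorAlgebra 𝔽 V ⊗[𝔽] V), (antipode b p).rTensor V
      (leftMul (ExteriorAlgebra.ι 𝔽 (b k)) z) =
      (antipodeGen b p (b k)).rTensor V ((antipode b p).rTensor V z) := by
    intro k z
    induction z using TensorProduct.induction_on with
    | zero => simp
    | tmul x v => simp [antipode_ι_mul]
    | add z z' h h' => simp only [map_add, h, h']
  refine b.ext fun i => ?_
  rw [LinearMap.comp_apply]
  induction u using induction_left b generalizing i with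
  | h1 => rw [antipode_one, genBraid_one, LinearMap.rTensor_tmul, antipode_one]
  | hadd x y hx hy => simp only [map_add, LinearMap.add_apply, hx, hy]
  | hsmul c x hx => simp only [map_smul, LinearMap.smul_apply, hx]
  | hmul m x hx =>
    rw [antipode_ι_mul, genBraid_antipodeGen, genBraid_basis_mul, map_sub, map_smul, map_smul,
      key, key, hx, hx]

/-- `∇(S ⊗ id)Δ = ηε`. -/
theorem antipode_left (b : Module.Basis ι 𝔽 V) (p : 𝔽) (x : ExteriorAlgebra 𝔽 V) :
    LinearMap.mul' 𝔽 (ExteriorAlgebra 𝔽 V) ((antipode b p).rTensor (ExteriorAlgebra 𝔽 V) (comul b p x)) =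
      algebraMap 𝔽 (ExteriorAlgebra 𝔽 V) (ExteriorAlgebra.algebraMapInv x) := by
  induction x using induction_left b with
  | h1 => simp [comul_one, antipode_one]
  | hadd x y hx hy => simp only [map_add, hx, hy]
  | hsmul c x hx =>
    rw [map_smul, map_smul, map_smul, map_smul, hx, smul_eq_mul, map_mul, Algebra.smul_def]
  | hmul k x hx =>
    have h0 : ExteriorAlgebra.algebraMapInv (ExteriorAlgebra.ι 𝔽 (b k) * x) = 0 := by
      simp [ExteriorAlgebra.algebraMapInv]
    rw [h0, comul_ι_mul, map_zero]
    induction comul b p x using TensorProduct.induction_on with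
    | zero => simp
    | tmul y w =>
      rw [leftGen_tmul, rightGen_tmul, map_add, map_add, LinearMap.rTensor_tmul, antipode_ι_mul,
        antipodeGen_apply, genBraid_antipode]
      induction genBraid b p y (b k) using TensorProduct.induction_on with
      | zero => simp
      | tmul a v => simp [mul_assoc]
      | add z z' h h' =>
        simp only [LinearMap.mul'_apply] at h h' ⊢
        simp only [map_add, LinearMap.add_apply, neg_add, add_mul]
        linear_combination (norm := module) h + h'
    | add z z' h h' =>
      simp only [map_add] at h h' ⊢
      linear_combination (norm := module) h + h'

/-- `∇(id ⊗ S)Δ = ηε`. -/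
theorem antipode_right (b : Module.Basis ι 𝔽 V) (p : 𝔽) (x : ExteriorAlgebra 𝔽 V) :
    LinearMap.mul' 𝔽 (ExteriorAlgebra 𝔽 V) ((antipode b p).lTensor (ExteriorAlgebra 𝔽 V) (comul b p x)) =
      algebraMap 𝔽 (ExteriorAlgebra 𝔽 V) (ExteriorAlgebra.algebraMapInv x) := by
  have key : ∀ (v : V) (z : ExteriorAlgebra 𝔽 V ⊗[𝔽] ExteriorAlgebra 𝔽 V),
      LinearMap.mul' 𝔽 (ExteriorAlgebra 𝔽 V) ((antipode b p).lTensor (ExteriorAlgebra 𝔽 V) (rightGen b p v z)) =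
      antipodeGen b p v (LinearMap.mul' 𝔽 (ExteriorAlgebra 𝔽 V) ((antipode b p).lTensor (ExteriorAlgebra 𝔽 V) z)) := by
    intro v z
    induction z using TensorProduct.induction_on with
    | zero => simp
    | tmul y w =>
      rw [rightGen_tmul, LinearMap.lTensor_tmul, LinearMap.mul'_apply, antipodeGen_apply,
        genBraid_mul_general]
      induction genBraid b p y v using TensorProduct.induction_on with
      | zero => simp
      | tmul a v' =>
        rw [absorb_tmul, LinearMap.lTensor_tmul, LinearMap.mul'_apply, antipode_ι_mul,
          antipodeGen_apply, TensorProduct.lift.tmul, LinearMap.compl₂_apply]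
        induction genBraid b p (antipode b p w) v' using TensorProduct.induction_on with
        | zero => simp
        | tmul c u => simp [mul_assoc]
        | add z z' h h' =>
          simp only [map_add, neg_add, mul_add] at h h' ⊢
          rw [h, h']
      | add z z' h h' =>
        simp only [map_add, LinearMap.add_apply, neg_add] at h h' ⊢
        rw [h, h']
    | add z z' h h' => simp only [map_add, h, h']
  have key' : ∀ (v : V) (z : ExteriorAlgebra 𝔽 V ⊗[𝔽] ExteriorAlgebra 𝔽 V),
      LinearMap.mul' 𝔽 (ExteriorAlgebra 𝔽 V) ((antipode b p).lTensor (ExteriorAlgebra 𝔽 V) (leftGen v z)) =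
      ExteriorAlgebra.ι 𝔽 v *
        LinearMap.mul' 𝔽 (ExteriorAlgebra 𝔽 V) ((antipode b p).lTensor (ExteriorAlgebra 𝔽 V) z) := by
    intro v z
    induction z using TensorProduct.induction_on with
    | zero => simp
    | tmul y w => simp [mul_assoc]
    | add z z' h h' => simp only [map_add, h, h', mul_add]
  induction x using induction_left b with
  | h1 => simp [comul_one, antipode_one]
  | hadd x y hx hy => simp only [map_add, hx, hy]
  | hsmul c x hx =>
    rw [map_smul, map_smul, map_smul, map_smul, hx, smul_eq_mul, map_mul, Algebra.smul_def]
  | hmul k x hx =>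
    have h0 : ExteriorAlgebra.algebraMapInv (ExteriorAlgebra.ι 𝔽 (b k) * x) = 0 := by
      simp [ExteriorAlgebra.algebraMapInv]
    rw [h0, comul_ι_mul, map_zero, map_add, map_add, key, key', hx,
      Algebra.algebraMap_eq_smul_one, map_smul]
    simp [antipodeGen_apply, genBraid_one]

/-- Compatibility of the braiding with the product in the first argument:
`τ̂(∇ ⊗ id) = (id ⊗ ∇)(τ̂ ⊗ id)(id ⊗ τ̂)`. -/
theorem braid_mul_tmul (b : Module.Basis ι 𝔽 V) (p : 𝔽) (x y z : ExteriorAlgebra 𝔽 V) :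
    braid b p ((x * y) ⊗ₜ[𝔽] z) =
      (LinearMap.mul' 𝔽 (ExteriorAlgebra 𝔽 V)).lTensor (ExteriorAlgebra 𝔽 V) (TensorProduct.assoc 𝔽 _ _ _
        ((braid b p).rTensor (ExteriorAlgebra 𝔽 V) ((TensorProduct.assoc 𝔽 _ _ _).symm
          (x ⊗ₜ[𝔽] braid b p (y ⊗ₜ[𝔽] z))))) := by
  rw [braid_mul_tmul_aux]
  induction braid b p (y ⊗ₜ[𝔽] z) using TensorProduct.induction_on with
  | zero => simp
  | tmul u w =>
    simp only [TensorProduct.lift.tmul, LinearMap.compl₁₂_apply, LinearMap.comp_apply,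
      TensorProduct.mk_apply, LinearMap.id_apply, TensorProduct.assoc_symm_tmul,
      LinearMap.rTensor_tmul]
    induction braid b p (x ⊗ₜ[𝔽] u) using TensorProduct.induction_on with
    | zero => simp
    | tmul a c => simp
    | add s s' h h' => simp only [map_add, LinearMap.add_apply, TensorProduct.add_tmul, h, h']
  | add s s' h h' => simp only [map_add, TensorProduct.tmul_add, h, h']

/-- Compatibility of the braiding with the product in the second argument:
`τ̂(id ⊗ ∇) = (∇ ⊗ id)(id ⊗ τ̂)(τ̂ ⊗ id)`. -/
theorem braid_tmul_mul (b : Module.Basis ι 𝔽 V) (p : 𝔽) (x y z : ExteriorAlgebra 𝔽 V) :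
    braid b p (x ⊗ₜ[𝔽] (y * z)) =
      (LinearMap.mul' 𝔽 (ExteriorAlgebra 𝔽 V)).rTensor (ExteriorAlgebra 𝔽 V) ((TensorProduct.assoc 𝔽 _ _ _).symm
        ((braid b p).lTensor (ExteriorAlgebra 𝔽 V) (TensorProduct.assoc 𝔽 _ _ _
          (braid b p (x ⊗ₜ[𝔽] y) ⊗ₜ[𝔽] z)))) := by
  rw [braid_tmul_mul_aux]
  induction braid b p (x ⊗ₜ[𝔽] y) using TensorProduct.induction_on with
  | zero => simp
  | tmul u w =>
    simp only [TensorProduct.lift.tmul, LinearMap.compl₂_apply, LinearMap.comp_apply,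
      LinearMap.flip_apply, TensorProduct.mk_apply, TensorProduct.assoc_tmul,
      LinearMap.lTensor_tmul]
    induction braid b p (w ⊗ₜ[𝔽] z) using TensorProduct.induction_on with
    | zero => simp
    | tmul a c => simp
    | add s s' h h' => simp only [map_add, TensorProduct.tmul_add, h, h']
  | add s s' h h' => simp only [map_add, TensorProduct.add_tmul, h, h']

/-- Compatibility of product and coproduct: `Δ∇ = (∇ ⊗ ∇)(id ⊗ τ̂ ⊗ id)(Δ ⊗ Δ)`. -/
theorem comul_mul (b : Module.Basis ι 𝔽 V) (p : 𝔽) (x y : ExteriorAlgebra 𝔽 V) :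
    comul b p (x * y) =
      TensorProduct.map (LinearMap.mul' 𝔽 (ExteriorAlgebra 𝔽 V)) (LinearMap.mul' 𝔽 (ExteriorAlgebra 𝔽 V))
        ((TensorProduct.assoc 𝔽 _ _ _).symm (((TensorProduct.assoc 𝔽 _ _ _).toLinearMap ∘ₗ
          (braid b p).rTensor (ExteriorAlgebra 𝔽 V) ∘ₗ (TensorProduct.assoc 𝔽 _ _ _).symm.toLinearMap).lTensor
            (ExteriorAlgebra 𝔽 V) (TensorProduct.assoc 𝔽 _ _ _ (comul b p x ⊗ₜ[𝔽] comul b p y)))) := by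
  rw [comul_mul_aux]
  induction comul b p x using TensorProduct.induction_on with
  | zero => simp
  | tmul u w =>
    induction comul b p y using TensorProduct.induction_on with
    | zero => simp
    | tmul u' w' =>
      simp only [sqMul_tmul, TensorProduct.assoc_tmul, LinearMap.lTensor_tmul,
        LinearMap.comp_apply, LinearEquiv.coe_coe, TensorProduct.assoc_symm_tmul,
        LinearMap.rTensor_tmul]
      induction braid b p (w ⊗ₜ[𝔽] u') using TensorProduct.induction_on with
      | zero => simp
      | tmul a c => simp
      | add s s' h h' =>
        simp only [map_add, LinearMap.add_apply, TensorProduct.add_tmul, TensorProduct.tmul_add,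
          h, h']
    | add s s' h h' => simp only [map_add, TensorProduct.tmul_add, h, h']
  | add s s' h h' =>
    simp only [map_add, LinearMap.add_apply, TensorProduct.add_tmul, h, h']

/-! The `R`-matrix of the diagonal automorphism `φ_t` and its coefficients. -/

/-- The diagonal automorphism `φ_t`, multiplication by `t` on `V`. -/
def diagAut (t : 𝔽) : ExteriorAlgebra 𝔽 V →ₐ[𝔽] ExteriorAlgebra 𝔽 V :=
  ExteriorAlgebra.map (t • LinearMap.id)

/-- The right action
`λ_R = ∇⁽²⁾(S φ_t ⊗ id ⊗ id)(τ̂ ⊗ id)(id ⊗ Δ) : Λ ⊗ Λ → Λ`. -/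
def rightAction (b : Module.Basis ι 𝔽 V) (p t : 𝔽) : ExteriorAlgebra 𝔽 V ⊗[𝔽] ExteriorAlgebra 𝔽 V →ₗ[𝔽] ExteriorAlgebra 𝔽 V :=
  LinearMap.mul' 𝔽 (ExteriorAlgebra 𝔽 V) ∘ₗ
    (LinearMap.mul' 𝔽 (ExteriorAlgebra 𝔽 V)).rTensor (ExteriorAlgebra 𝔽 V) ∘ₗ
    ((antipode b p ∘ₗ (diagAut t).toLinearMap).rTensor (ExteriorAlgebra 𝔽 V)).rTensor (ExteriorAlgebra 𝔽 V) ∘ₗ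
    (braid b p).rTensor (ExteriorAlgebra 𝔽 V) ∘ₗ
    (TensorProduct.assoc 𝔽 (ExteriorAlgebra 𝔽 V) (ExteriorAlgebra 𝔽 V) (ExteriorAlgebra 𝔽 V)).symm.toLinearMap ∘ₗ
    (comul b p).lTensor (ExteriorAlgebra 𝔽 V)

/-- The `R`-matrix `ρ = (φ_t ⊗ λ_R)(τ̂ ⊗ id)(id ⊗ Δ)`. -/
def rho (b : Module.Basis ι 𝔽 V) (p t : 𝔽) :
    ExteriorAlgebra 𝔽 V ⊗[𝔽] ExteriorAlgebra 𝔽 V →ₗ[𝔽] ExteriorAlgebra 𝔽 V ⊗[𝔽] ExteriorAlgebra 𝔽 V :=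
  TensorProduct.map (diagAut t).toLinearMap (rightAction b p t) ∘ₗ
    (TensorProduct.assoc 𝔽 (ExteriorAlgebra 𝔽 V) (ExteriorAlgebra 𝔽 V) (ExteriorAlgebra 𝔽 V)).toLinearMap ∘ₗ
    (braid b p).rTensor (ExteriorAlgebra 𝔽 V) ∘ₗ
    (TensorProduct.assoc 𝔽 (ExteriorAlgebra 𝔽 V) (ExteriorAlgebra 𝔽 V) (ExteriorAlgebra 𝔽 V)).symm.toLinearMap ∘ₗ
    (comul b p).lTensor (ExteriorAlgebra 𝔽 V)

/-- The set-theoretic basis: `f_E` is the product of the elements of `E` in increasing order. -/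
def setBasis (b : Module.Basis ι 𝔽 V) : Module.Basis (Finset ι) 𝔽 (ExteriorAlgebra 𝔽 V) := b.ExteriorAlgebra

/-- `θ_{A,B} = ∑_{a ∈ A} ∑_{b ∈ B} θ_{a,b}`. -/
def thetaSet (A B : Finset ι) : ℕ := ∑ a ∈ A, ∑ c ∈ B, theta a c

/-- `E' = (E \ G) ∪ H`; similarly `F' = (F \ H) ∪ G` is `exchange F H G`. -/
def exchange (E G H : Finset ι) : Finset ι := (E \ G) ∪ H

/-- The `q`-Pochhammer symbol `(x; q)_n`. -/
def pochhammer (x q : 𝔽) (n : ℕ) : 𝔽 := ∏ i ∈ Finset.range n, (1 - x * q ^ i)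

/-- `α_{G,H}`, a product over the one-element subsets of `G`. -/
def alpha (p : 𝔽) (G H : Finset ι) : 𝔽 :=
  ∏ a ∈ G, (p ^ ((thetaSet {a} H : ℤ) - (thetaSet {a} G : ℤ)) - 1)

/-- `β_{E,G;F,H} = (-1)^(θ_{F,E} + θ_{F',E'}) p^(θ_{G ⊔ C,E} + θ_{Ḟ,E'}) α_{G,H}`, where
`C = E ∩ F` and `Ḟ = (F \ E) \ H`. -/
def beta (p : 𝔽) (E G F H : Finset ι) : 𝔽 :=
  (-1) ^ (thetaSet F E + thetaSet (exchange F H G) (exchange E G H)) *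
    p ^ (thetaSet (G ∪ (E ∩ F)) E + thetaSet ((F \ E) \ H) (exchange E G H)) * alpha p G H

/-- The matrix coefficient `r_{E,G;F,H}` of `ρ`: up to the sign `(-1)^(|E||F|)`, the coefficient of
`f_{F'} ⊗ f_{E'}` in `ρ(f_E ⊗ f_F)`. -/
def rhoCoeff (b : Module.Basis ι 𝔽 V) (p t : 𝔽) (E G F H : Finset ι) : 𝔽 :=
  (-1) ^ (E.card * F.card) * ((setBasis b).tensorProduct (setBasis b)).repr
    (rho b p t (setBasis b E ⊗ₜ[𝔽] setBasis b F)) (exchange F H G, exchange E G H)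

end HeckeExterior

end

open scoped TensorProduct

noncomputable section

namespace HeckeExterior

variable {𝔽 V ι : Type*} [Field 𝔽] [AddCommGroup V] [Module 𝔽 V] [LinearOrder ι]

/-! The map `ρ` is multiplicative in its second argument (`rho_tmul_mul`): writing `rhoAct z` for
the map `a ⊗ x ↦ (a ⊗ 1) ρ(x ⊗ z)`, one has `ρ(x ⊗ yz) = rhoAct z (ρ(x ⊗ y))`. Hence `ρ(f_E ⊗ f_F)`
is computed by letting the generators in `F` act one after another, and only `ρ(x ⊗ v)` with `v ∈ V`
has to be known.

For a generator, `ρ(x ⊗ v) = t τ̂(x ⊗ v) + 1 ⊗ (x - t φ_p(x)) v`. The second term is `1 ⊗ λ_R(x ⊗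
v)`; it comes from the identity `∇τ̂(x ⊗ v) = φ_p(x) v`, which holds because `∇τ = p∇` on `V ⊗ V` in
the exterior algebra. On `x = f_E` it supplies the factor `1 - t p^|E|`, and these factors build up
the Pochhammer symbol. The first term is explicit (`braid_setBasis_tmul_ι`): the generator `i`
either passes through `E`, or displaces a single `a ∈ E` with `a > i`.

Split `F` into `C = E ∩ F` and `D = F \ E`. On `C` only one term survives, as every other one
contains a squared generator (`rho_tmul_of_subset`). On `D` the generators act in increasing order,
and the coefficients obey a recursion (`disjointCoeff_insert`): `i` stays in `F'`, or it enters `E'`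
directly, or it enters `E'` by displacing some `a`. Once powers of `p` and `t` are removed, this is
the identity `alpha_insert_right` for `α`. Signs are handled by the normalization `signedTensor`,
under which all terms of one step share the same sign. Finally `α_{G,H} = 0` for `|H| < |G|`
(`alpha_eq_zero`), which restricts the sum and makes the truncated subtraction `|H| - |G|` harmless.
-/

/-! ### Scaling automorphisms and the braiding. -/

theorem diagAut_ι_mul (c : 𝔽) (v : V) (x : ExteriorAlgebra 𝔽 V) :
    diagAut c (ExteriorAlgebra.ι 𝔽 v * x) = c • (ExteriorAlgebra.ι 𝔽 v * diagAut c x) := by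
  simp [diagAut]

/-- The braiding `τ` is homogeneous: each generator factor of `y` moves from the second tensor
position to the first, taking its scalar `c` along. -/
theorem genBraid_diagAut (b : Module.Basis ι 𝔽 V) (p c : 𝔽) (y : ExteriorAlgebra 𝔽 V) (v : V) :
    genBraid b p (diagAut c y) v = (diagAut c).toLinearMap.rTensor V (genBraid b p y v) := by
  have key : ∀ (w : V) (z : ExteriorAlgebra 𝔽 V ⊗[𝔽] V), (diagAut c).toLinearMap.rTensor V
      (leftMul (ExteriorAlgebra.ι 𝔽 w) z) =
      c • leftMul (ExteriorAlgebra.ι 𝔽 w) ((diagAut c).toLinearMap.rTensor V z) := by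
    intro w z
    induction z using TensorProduct.induction_on with
    | zero => simp
    | tmul x v => simp [diagAut_ι_mul, TensorProduct.smul_tmul']
    | add z z' h h' => simp only [map_add, h, h', smul_add]
  suffices h : genBraid b p (diagAut c y) =
      (diagAut c).toLinearMap.rTensor V ∘ₗ genBraid b p y from congr($h v)
  refine b.ext fun i => ?_
  rw [LinearMap.comp_apply]
  induction y using induction_left b generalizing i with
  | h1 => simp [genBraid_one]
  | hadd x y hx hy => simp only [map_add, LinearMap.add_apply, hx, hy]
  | hsmul c x hx => simp only [map_smul, LinearMap.smul_apply, hx]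
  | hmul k x hx =>
    rw [diagAut_ι_mul, map_smul, LinearMap.smul_apply, genBraid_basis_mul, genBraid_basis_mul,
      hx, hx, map_sub, map_smul, map_smul, key, key]
    module

theorem braid_diagAut (b : Module.Basis ι 𝔽 V) (p c : 𝔽) (x y : ExteriorAlgebra 𝔽 V) :
    braid b p (diagAut c x ⊗ₜ[𝔽] y) =
      (diagAut c).toLinearMap.lTensor (ExteriorAlgebra 𝔽 V) (braid b p (x ⊗ₜ[𝔽] y)) := by
  have key : ∀ (v : V) (z : ExteriorAlgebra 𝔽 V ⊗[𝔽] ExteriorAlgebra 𝔽 V),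
      (diagAut c).toLinearMap.lTensor (ExteriorAlgebra 𝔽 V) (rightGen b p v z) =
      c • rightGen b p v ((diagAut c).toLinearMap.lTensor (ExteriorAlgebra 𝔽 V) z) := by
    intro v z
    induction z using TensorProduct.induction_on with
    | zero => simp
    | tmul a y =>
      rw [rightGen_tmul, LinearMap.lTensor_tmul, rightGen_tmul]
      induction genBraid b p a v using TensorProduct.induction_on with
      | zero => simp
      | tmul a w => simp [diagAut_ι_mul]
      | add z z' h h' => simp only [map_add, LinearMap.add_apply, h, h', smul_add]
    | add z z' h h' => simp only [map_add, h, h', smul_add]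
  induction x using induction_left b with
  | h1 => simp [braid_one_tmul]
  | hadd x y hx hy => simp only [map_add, TensorProduct.add_tmul, hx, hy]
  | hsmul c x hx => simp only [map_smul, ← TensorProduct.smul_tmul', hx]
  | hmul k x hx =>
    rw [diagAut_ι_mul, ← TensorProduct.smul_tmul', map_smul, braid_ι_mul, braid_ι_mul, hx, key]

/-! ### Braiding an element of the exterior algebra past a single vector. -/

theorem rightGen_ι_tmul (b : Module.Basis ι 𝔽 V) (p : 𝔽) (u w : V) (y : ExteriorAlgebra 𝔽 V) :
    rightGen b p u (ExteriorAlgebra.ι 𝔽 w ⊗ₜ[𝔽] y) =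
      TensorProduct.map (ExteriorAlgebra.ι 𝔽)
        ((LinearMap.mul 𝔽 (ExteriorAlgebra 𝔽 V)).flip y ∘ₗ ExteriorAlgebra.ι 𝔽)
        (hecke b p (u ⊗ₜ[𝔽] w)) := by
  have h := braid_ι_tmul_ι b p u w
  rw [← mul_one (ExteriorAlgebra.ι 𝔽 u), braid_ι_mul, braid_one_tmul] at h
  have h' := congr(mulR $h y)
  rw [← rightGen_mulR, mulR_tmul, one_mul] at h'
  rw [h']
  induction hecke b p (u ⊗ₜ[𝔽] w) using TensorProduct.induction_on with
  | zero => simp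
  | tmul a w => simp
  | add z z' h h' => simp only [map_add, LinearMap.add_apply, h, h']

/-- The braiding carries `Λ ⊗ V` to `V ⊗ Λ`. -/
theorem exists_braid_tmul_ι (b : Module.Basis ι 𝔽 V) (p : 𝔽) (x : ExteriorAlgebra 𝔽 V) (v : V) :
    ∃ z : V ⊗[𝔽] ExteriorAlgebra 𝔽 V, braid b p (x ⊗ₜ[𝔽] ExteriorAlgebra.ι 𝔽 v) =
      (ExteriorAlgebra.ι 𝔽).rTensor (ExteriorAlgebra 𝔽 V) z := by
  have key : ∀ (u : V) (z : V ⊗[𝔽] ExteriorAlgebra 𝔽 V), ∃ z' : V ⊗[𝔽] ExteriorAlgebra 𝔽 V,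
      rightGen b p u ((ExteriorAlgebra.ι 𝔽).rTensor (ExteriorAlgebra 𝔽 V) z) =
      (ExteriorAlgebra.ι 𝔽).rTensor (ExteriorAlgebra 𝔽 V) z' := by
    intro u z
    induction z using TensorProduct.induction_on with
    | zero => exact ⟨0, by simp⟩
    | tmul w y =>
      refine ⟨((LinearMap.mul 𝔽 (ExteriorAlgebra 𝔽 V)).flip y ∘ₗ ExteriorAlgebra.ι 𝔽).lTensor V
        (hecke b p (u ⊗ₜ[𝔽] w)), ?_⟩
      rw [LinearMap.rTensor_tmul, rightGen_ι_tmul, ← LinearMap.rTensor_comp_lTensor]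
      rfl
    | add z z' h h' =>
      obtain ⟨s, hs⟩ := h
      obtain ⟨s', hs'⟩ := h'
      exact ⟨s + s', by simp only [map_add, hs, hs']⟩
  induction x using induction_left b with
  | h1 => exact ⟨v ⊗ₜ 1, by simp [braid_one_tmul]⟩
  | hadd x y hx hy =>
    obtain ⟨s, hs⟩ := hx
    obtain ⟨s', hs'⟩ := hy
    exact ⟨s + s', by rw [TensorProduct.add_tmul, map_add, hs, hs', map_add]⟩
  | hsmul c x hx =>
    obtain ⟨s, hs⟩ := hx
    exact ⟨c • s, by rw [← TensorProduct.smul_tmul', map_smul, hs, map_smul]⟩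
  | hmul k x hx =>
    obtain ⟨s, hs⟩ := hx
    rw [braid_ι_mul, hs]
    exact key _ _

/-- The eigenvalues of the Hecke braiding are `p` and `-1`; the exterior product only sees the
eigenvalue `p`. On basis vectors this is the sign rule for swapping two factors. -/
theorem mul_map_hecke (b : Module.Basis ι 𝔽 V) (p : 𝔽) (u w : V) :
    LinearMap.mul' 𝔽 (ExteriorAlgebra 𝔽 V) (TensorProduct.map (ExteriorAlgebra.ι 𝔽)
      (ExteriorAlgebra.ι 𝔽) (hecke b p (u ⊗ₜ[𝔽] w))) =
      p • (ExteriorAlgebra.ι 𝔽 u * ExteriorAlgebra.ι 𝔽 w) := by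
  suffices h : LinearMap.mul' 𝔽 (ExteriorAlgebra 𝔽 V) ∘ₗ TensorProduct.map (ExteriorAlgebra.ι 𝔽)
      (ExteriorAlgebra.ι 𝔽) ∘ₗ hecke b p = p • (LinearMap.mul' 𝔽 (ExteriorAlgebra 𝔽 V) ∘ₗ
        TensorProduct.map (ExteriorAlgebra.ι 𝔽) (ExteriorAlgebra.ι 𝔽)) from
    congr($h (u ⊗ₜ[𝔽] w))
  refine (b.tensorProduct b).ext fun ⟨i, j⟩ => ?_
  simp only [Module.Basis.tensorProduct_apply, LinearMap.comp_apply, LinearMap.smul_apply,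
    hecke_basis, map_sub, map_smul, TensorProduct.map_tmul, LinearMap.mul'_apply]
  rcases lt_trichotomy i j with h | rfl | h
  · rw [ι_mul_swap (b j), theta_of_lt h, theta_of_gt h]
    module
  · simp
  · rw [ι_mul_swap (b j), theta_of_lt h, theta_of_gt h]
    module

/-- Each factor of `x` that passes the vector contributes one `p`. The induction works because the
first leg of `τ̂(x ⊗ v)` stays in `V` (`exists_braid_tmul_ι`), so that `mul_map_hecke` applies to
the next factor. -/
theorem mul_braid_tmul_ι (b : Module.Basis ι 𝔽 V) (p : 𝔽) (x : ExteriorAlgebra 𝔽 V) (v : V) :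
    LinearMap.mul' 𝔽 (ExteriorAlgebra 𝔽 V) (braid b p (x ⊗ₜ[𝔽] ExteriorAlgebra.ι 𝔽 v)) =
      diagAut p x * ExteriorAlgebra.ι 𝔽 v := by
  have key : ∀ (u : V) (z : V ⊗[𝔽] ExteriorAlgebra 𝔽 V),
      LinearMap.mul' 𝔽 (ExteriorAlgebra 𝔽 V)
        (rightGen b p u ((ExteriorAlgebra.ι 𝔽).rTensor (ExteriorAlgebra 𝔽 V) z)) =
      p • (ExteriorAlgebra.ι 𝔽 u * LinearMap.mul' 𝔽 (ExteriorAlgebra 𝔽 V)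
        ((ExteriorAlgebra.ι 𝔽).rTensor (ExteriorAlgebra 𝔽 V) z)) := by
    intro u z
    induction z using TensorProduct.induction_on with
    | zero => simp
    | tmul w y =>
      rw [LinearMap.rTensor_tmul, rightGen_ι_tmul, LinearMap.mul'_apply, ← mul_assoc,
        ← smul_mul_assoc, ← mul_map_hecke b]
      induction hecke b p (u ⊗ₜ[𝔽] w) using TensorProduct.induction_on with
      | zero => simp
      | tmul a w => simp [mul_assoc]
      | add z z' h h' => simp only [map_add, add_mul, h, h']
    | add z z' h h' => simp only [map_add, mul_add, smul_add, h, h']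
  induction x using induction_left b with
  | h1 => simp [braid_one_tmul]
  | hadd x y hx hy => simp only [TensorProduct.add_tmul, map_add, add_mul, hx, hy]
  | hsmul c x hx => rw [← TensorProduct.smul_tmul', map_smul, map_smul, hx, map_smul, smul_mul_assoc]
  | hmul k x hx =>
    obtain ⟨s, hs⟩ := exists_braid_tmul_ι b p x v
    rw [braid_ι_mul, hs, key, ← hs, hx, diagAut_ι_mul, smul_mul_assoc, mul_assoc]

/-! ### The right action `λ_R`. -/

/-- `a ⊗ c ↦ S(φ_t(a)) c`. -/
def twistMul (b : Module.Basis ι 𝔽 V) (p t : 𝔽) :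
    ExteriorAlgebra 𝔽 V ⊗[𝔽] ExteriorAlgebra 𝔽 V →ₗ[𝔽] ExteriorAlgebra 𝔽 V :=
  LinearMap.mul' 𝔽 (ExteriorAlgebra 𝔽 V) ∘ₗ
    (antipode b p ∘ₗ (diagAut t).toLinearMap).rTensor (ExteriorAlgebra 𝔽 V)

theorem twistMul_tmul (b : Module.Basis ι 𝔽 V) (p t : 𝔽) (a c : ExteriorAlgebra 𝔽 V) :
    twistMul b p t (a ⊗ₜ[𝔽] c) = antipode b p (diagAut t a) * c := rfl

/-- On `a ⊗ c`: `Sφ_t(wa) = t S(w φ_t(a)) = -t ∇τ̂(w ⊗ Sφ_t(a))`, and braiding with `w` commutes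
with `S` and `φ_t`. So a vector on the far left may be braided past `a` at the price of `-t`. -/
theorem twistMul_leftGen (b : Module.Basis ι 𝔽 V) (p t : 𝔽) (w : V)
    (z : ExteriorAlgebra 𝔽 V ⊗[𝔽] ExteriorAlgebra 𝔽 V) :
    twistMul b p t (leftGen w z) = -t • twistMul b p t (rightGen b p w z) := by
  induction z using TensorProduct.induction_on with
  | zero => simp
  | tmul a c =>
    rw [leftGen_tmul, twistMul_tmul, diagAut_ι_mul, map_smul, antipode_ι_mul, antipodeGen_apply,
      genBraid_antipode, genBraid_diagAut, rightGen_tmul]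
    induction genBraid b p a w using TensorProduct.induction_on with
    | zero => simp
    | tmul a' w' => simp [twistMul_tmul, mul_assoc]
    | add z z' h h' =>
      simp only [map_add, LinearMap.add_apply, smul_add, neg_add, add_mul] at h h' ⊢
      rw [← h, ← h']
  | add z z' h h' => simp only [map_add, smul_add, h, h']

theorem twistMul_mulR (b : Module.Basis ι 𝔽 V) (p t : 𝔽) (c : ExteriorAlgebra 𝔽 V)
    (z : ExteriorAlgebra 𝔽 V ⊗[𝔽] ExteriorAlgebra 𝔽 V) :
    twistMul b p t (mulR z c) = twistMul b p t z * c := by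
  induction z using TensorProduct.induction_on with
  | zero => simp
  | tmul a c => simp [twistMul_tmul, mul_assoc]
  | add z z' h h' => simp only [map_add, LinearMap.add_apply, add_mul, h, h']

/-- Braiding `x` past `v` first leaves a vector in front; `twistMul_leftGen` returns this vector to
the element being braided past `u`. What is then braided is `∇τ̂(x ⊗ v) = φ_p(x) v`. -/
theorem twistMul_braid_tmul_ι_mul (b : Module.Basis ι 𝔽 V) (p t : 𝔽) (v : V)
    (x u : ExteriorAlgebra 𝔽 V) :
    twistMul b p t (braid b p (x ⊗ₜ[𝔽] (ExteriorAlgebra.ι 𝔽 v * u))) =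
      -t • twistMul b p t (braid b p ((diagAut p x * ExteriorAlgebra.ι 𝔽 v) ⊗ₜ[𝔽] u)) := by
  rw [← mul_braid_tmul_ι b, braid_tmul_mul_aux]
  obtain ⟨s, hs⟩ := exists_braid_tmul_ι b p x v
  rw [hs]
  clear hs
  induction s using TensorProduct.induction_on with
  | zero => simp
  | tmul w y =>
    rw [LinearMap.rTensor_tmul, LinearMap.mul'_apply, braid_ι_mul, ← twistMul_leftGen]
    rfl
  | add z z' h h' => simp only [map_add, TensorProduct.add_tmul, smul_add, h, h']

theorem braid_mul_ι_tmul (b : Module.Basis ι 𝔽 V) (p : 𝔽) (v : V) (x u : ExteriorAlgebra 𝔽 V) :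
    braid b p ((x * ExteriorAlgebra.ι 𝔽 v) ⊗ₜ[𝔽] u) =
      TensorProduct.lift (mulR.compl₁₂ (braid b p ∘ₗ TensorProduct.mk 𝔽 _ _ x) (ExteriorAlgebra.ι 𝔽))
        (genBraid b p u v) := by
  have h := braid_ι_mul b p v 1 u
  rw [mul_one, braid_one_tmul, rightGen_tmul] at h
  rw [braid_mul_tmul_aux, h]
  induction genBraid b p u v using TensorProduct.induction_on with
  | zero => simp
  | tmul a' w' => simp
  | add z z' h h' => simp only [map_add, LinearMap.add_apply, h, h']

theorem rightAction_tmul (b : Module.Basis ι 𝔽 V) (p t : 𝔽) (x y : ExteriorAlgebra 𝔽 V) :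
    rightAction b p t (x ⊗ₜ[𝔽] y) =
      LinearMap.mul' 𝔽 (ExteriorAlgebra 𝔽 V) ((twistMul b p t ∘ₗ braid b p ∘ₗ
        TensorProduct.mk 𝔽 _ _ x).rTensor (ExteriorAlgebra 𝔽 V) (comul b p y)) := by
  simp only [rightAction, LinearMap.comp_apply, LinearMap.lTensor_tmul]
  induction comul b p y using TensorProduct.induction_on with
  | zero => simp
  | tmul a w =>
    simp only [LinearEquiv.coe_coe, TensorProduct.assoc_symm_tmul, LinearMap.rTensor_tmul]
    rfl
  | add z z' h h' => simp only [map_add, TensorProduct.tmul_add, h, h']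

/-- Of the two parts of `Δ(vy) = (v ⊗ 1 + 1 ⊗ v) Δ(y)`, the part `1 ⊗ v` contributes `xv` and the
part `v ⊗ 1` contributes `-t φ_p(x) v`. With `rightAction_tmul_one` this describes `λ_R` one
generator at a time. -/
theorem rightAction_ι_mul (b : Module.Basis ι 𝔽 V) (p t : 𝔽) (v : V) (x y : ExteriorAlgebra 𝔽 V) :
    rightAction b p t (x ⊗ₜ[𝔽] (ExteriorAlgebra.ι 𝔽 v * y)) =
      rightAction b p t (((x - t • diagAut p x) * ExteriorAlgebra.ι 𝔽 v) ⊗ₜ[𝔽] y) := by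
  rw [sub_mul, TensorProduct.sub_tmul, map_sub, smul_mul_assoc, ← TensorProduct.smul_tmul',
    map_smul]
  simp only [rightAction_tmul, comul_ι_mul, map_add]
  induction comul b p y using TensorProduct.induction_on with
  | zero => simp
  | tmul u w =>
    -- The vector `v` is braided past `u` and then multiplied in; this is the same as braiding `xv`
    -- past `u`.
    have h1 : LinearMap.mul' 𝔽 (ExteriorAlgebra 𝔽 V) ((twistMul b p t ∘ₗ braid b p ∘ₗ
        TensorProduct.mk 𝔽 _ _ x).rTensor (ExteriorAlgebra 𝔽 V) (rightGen b p v (u ⊗ₜ[𝔽] w))) =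
        twistMul b p t (braid b p ((x * ExteriorAlgebra.ι 𝔽 v) ⊗ₜ[𝔽] u)) * w := by
      rw [braid_mul_ι_tmul, rightGen_tmul]
      induction genBraid b p u v using TensorProduct.induction_on with
      | zero => simp
      | tmul a' w' => simp [twistMul_mulR, mul_assoc]
      | add z z' h h' => simp only [map_add, LinearMap.add_apply, add_mul, h, h']
    rw [h1, leftGen_tmul]
    simp only [LinearMap.rTensor_tmul, LinearMap.comp_apply, TensorProduct.mk_apply,
      twistMul_braid_tmul_ι_mul, LinearMap.mul'_apply, smul_mul_assoc]
    module
  | add z z' h h' =>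
    simp only [map_add] at h h' ⊢
    linear_combination (norm := module) h + h'

theorem rightAction_tmul_one (b : Module.Basis ι 𝔽 V) (p t : 𝔽) (x : ExteriorAlgebra 𝔽 V) :
    rightAction b p t (x ⊗ₜ[𝔽] 1) = x := by
  simp [rightAction_tmul, comul_one, braid_tmul_one, twistMul_tmul, antipode_one]

/-! ### Multiplicativity of `ρ` in its second argument. -/

/-- `a ⊗ c ↦ φ_t(a) ⊗ λ_R(c ⊗ w)`. -/
def twistAction (b : Module.Basis ι 𝔽 V) (p t : 𝔽) :
    ExteriorAlgebra 𝔽 V →ₗ[𝔽] Module.End 𝔽 (ExteriorAlgebra 𝔽 V ⊗[𝔽] ExteriorAlgebra 𝔽 V) :=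
  TensorProduct.mapBilinear (RingHom.id 𝔽) (ExteriorAlgebra 𝔽 V) (ExteriorAlgebra 𝔽 V)
    (ExteriorAlgebra 𝔽 V) (ExteriorAlgebra 𝔽 V) (diagAut t).toLinearMap ∘ₗ
    (TensorProduct.mk 𝔽 (ExteriorAlgebra 𝔽 V) (ExteriorAlgebra 𝔽 V)).flip.compr₂ (rightAction b p t)

theorem twistAction_tmul (b : Module.Basis ι 𝔽 V) (p t : 𝔽) (w a c : ExteriorAlgebra 𝔽 V) :
    twistAction b p t w (a ⊗ₜ[𝔽] c) = diagAut t a ⊗ₜ[𝔽] rightAction b p t (c ⊗ₜ[𝔽] w) := rfl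

theorem twistAction_mulL (b : Module.Basis ι 𝔽 V) (p t : 𝔽) (w c : ExteriorAlgebra 𝔽 V)
    (z : ExteriorAlgebra 𝔽 V ⊗[𝔽] ExteriorAlgebra 𝔽 V) :
    twistAction b p t w (mulL c z) = mulL (diagAut t c) (twistAction b p t w z) := by
  induction z using TensorProduct.induction_on with
  | zero => simp
  | tmul a c => simp [twistAction_tmul]
  | add z z' h h' => simp only [map_add, h, h']

theorem twistAction_ι_mul (b : Module.Basis ι 𝔽 V) (p t : 𝔽) (v : V) (w : ExteriorAlgebra 𝔽 V)
    (z : ExteriorAlgebra 𝔽 V ⊗[𝔽] ExteriorAlgebra 𝔽 V) :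
    twistAction b p t (ExteriorAlgebra.ι 𝔽 v * w) z =
      twistAction b p t w (mulR (z - t • (diagAut p).toLinearMap.lTensor (ExteriorAlgebra 𝔽 V) z)
        (ExteriorAlgebra.ι 𝔽 v)) := by
  induction z using TensorProduct.induction_on with
  | zero => simp
  | tmul a c =>
    rw [LinearMap.lTensor_tmul, ← TensorProduct.tmul_smul, ← TensorProduct.tmul_sub, mulR_tmul,
      twistAction_tmul, twistAction_tmul, rightAction_ι_mul]
    rfl
  | add z z' h h' =>
    simp only [map_add, map_sub, map_smul, smul_add, LinearMap.add_apply, LinearMap.sub_apply,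
      LinearMap.smul_apply] at h h' ⊢
    rw [h, h']
    module

/-- `u ⊗ w ↦ (φ_t ⊗ λ_R)(τ̂(x ⊗ u) ⊗ w)`. -/
def rhoAux (b : Module.Basis ι 𝔽 V) (p t : 𝔽) :
    ExteriorAlgebra 𝔽 V →ₗ[𝔽] Module.End 𝔽 (ExteriorAlgebra 𝔽 V ⊗[𝔽] ExteriorAlgebra 𝔽 V) :=
  (TensorProduct.lift.equiv (RingHom.id 𝔽) (ExteriorAlgebra 𝔽 V) (ExteriorAlgebra 𝔽 V)
    (ExteriorAlgebra 𝔽 V ⊗[𝔽] ExteriorAlgebra 𝔽 V)).toLinearMap ∘ₗ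
    LinearMap.llcomp 𝔽 _ _ _ (twistAction b p t).flip ∘ₗ TensorProduct.curry (braid b p)

theorem rhoAux_tmul (b : Module.Basis ι 𝔽 V) (p t : 𝔽) (x u w : ExteriorAlgebra 𝔽 V) :
    rhoAux b p t x (u ⊗ₜ[𝔽] w) = twistAction b p t w (braid b p (x ⊗ₜ[𝔽] u)) := by
  simp [rhoAux]

theorem rho_tmul (b : Module.Basis ι 𝔽 V) (p t : 𝔽) (x y : ExteriorAlgebra 𝔽 V) :
    rho b p t (x ⊗ₜ[𝔽] y) = rhoAux b p t x (comul b p y) := by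
  simp only [rho, LinearMap.comp_apply, LinearMap.lTensor_tmul]
  induction comul b p y using TensorProduct.induction_on with
  | zero => simp
  | tmul a w =>
    simp only [LinearEquiv.coe_coe, TensorProduct.assoc_symm_tmul, LinearMap.rTensor_tmul,
      rhoAux_tmul]
    induction braid b p (x ⊗ₜ[𝔽] a) using TensorProduct.induction_on with
    | zero => simp
    | tmul a' w' => simp [twistAction_tmul]
    | add z z' h h' => simp only [map_add, TensorProduct.add_tmul, h, h']
  | add z z' h h' => simp only [map_add, TensorProduct.tmul_add, h, h']

/-- The part `1 ⊗ v` of the coproduct of `v` only meets `λ_R`, where `rightAction_ι_mul` applies. -/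
theorem rhoAux_rightGen (b : Module.Basis ι 𝔽 V) (p t : 𝔽) (v : V) (x : ExteriorAlgebra 𝔽 V)
    (z : ExteriorAlgebra 𝔽 V ⊗[𝔽] ExteriorAlgebra 𝔽 V) :
    rhoAux b p t x (rightGen b p v z) =
      rhoAux b p t ((x - t • diagAut p x) * ExteriorAlgebra.ι 𝔽 v) z := by
  induction z using TensorProduct.induction_on with
  | zero => simp
  | tmul u w =>
    -- The operator `id - t φ_p` produced by `λ_R` sits on the second leg of `τ̂(x ⊗ -)`; by
    -- `braid_diagAut` it can be applied to `x` beforehand.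
    have h0 : braid b p ∘ₗ TensorProduct.mk 𝔽 _ _ (x - t • diagAut p x) =
        (LinearMap.id - t • (diagAut p).toLinearMap.lTensor (ExteriorAlgebra 𝔽 V)) ∘ₗ
          braid b p ∘ₗ TensorProduct.mk 𝔽 _ _ x := by
      refine LinearMap.ext fun y => ?_
      simp [braid_diagAut]
    rw [rightGen_tmul, rhoAux_tmul, braid_mul_ι_tmul, h0]
    induction genBraid b p u v using TensorProduct.induction_on with
    | zero => simp
    | tmul a' v' =>
      rw [absorb_tmul, rhoAux_tmul, twistAction_ι_mul]
      rfl
    | add z z' h h' => simp only [map_add, LinearMap.add_apply, h, h']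
  | add z z' h h' => simp only [map_add, h, h']

/-- The part `v ⊗ 1` is braided past `x` and then lies in `V` on the first leg, where `φ_t` turns it
into the factor `t`. -/
theorem rhoAux_leftGen (b : Module.Basis ι 𝔽 V) (p t : 𝔽) (v : V) (x : ExteriorAlgebra 𝔽 V)
    (z : ExteriorAlgebra 𝔽 V ⊗[𝔽] ExteriorAlgebra 𝔽 V) :
    rhoAux b p t x (leftGen v z) =
      t • TensorProduct.lift (mulL.compl₂ ((rhoAux b p t).flip z))
        (braid b p (x ⊗ₜ[𝔽] ExteriorAlgebra.ι 𝔽 v)) := by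
  induction z using TensorProduct.induction_on with
  | zero =>
    rw [map_zero, map_zero, map_zero]
    induction braid b p (x ⊗ₜ[𝔽] ExteriorAlgebra.ι 𝔽 v) using TensorProduct.induction_on with
    | zero => simp
    | tmul a' v' => simp
    | add z z' h h' => rw [map_add, smul_add, ← h, ← h', add_zero]
  | tmul u w =>
    obtain ⟨s, hs⟩ := exists_braid_tmul_ι b p x v
    rw [leftGen_tmul, rhoAux_tmul, braid_tmul_mul_aux, hs]
    clear hs
    induction s using TensorProduct.induction_on with
    | zero => simp
    | tmul a' y =>
      simp only [LinearMap.rTensor_tmul, TensorProduct.lift.tmul, LinearMap.compl₂_apply,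
        LinearMap.comp_apply, LinearMap.flip_apply, TensorProduct.mk_apply, twistAction_mulL,
        rhoAux_tmul]
      rw [← mul_one (ExteriorAlgebra.ι 𝔽 a'), diagAut_ι_mul]
      simp
    | add z z' h h' => simp only [map_add, smul_add, h, h']
  | add z z' h h' =>
    rw [map_add, map_add, h, h', ← smul_add]
    congr 1
    induction braid b p (x ⊗ₜ[𝔽] ExteriorAlgebra.ι 𝔽 v) using TensorProduct.induction_on with
    | zero => simp
    | tmul a' v' => simp
    | add z z' h h' =>
      simp only [map_add] at h h' ⊢
      rw [← h, ← h']
      abel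

theorem rho_tmul_one (b : Module.Basis ι 𝔽 V) (p t : 𝔽) (x : ExteriorAlgebra 𝔽 V) :
    rho b p t (x ⊗ₜ[𝔽] 1) = 1 ⊗ₜ[𝔽] x := by
  simp [rho_tmul, rhoAux_tmul, comul_one, braid_tmul_one, twistAction_tmul, rightAction_tmul_one]

/-- `a ⊗ x ↦ (a ⊗ 1) ρ(x ⊗ z)`, the right action of `z` on `Λ ⊗ Λ`. -/
def rhoAct (b : Module.Basis ι 𝔽 V) (p t : 𝔽) (z : ExteriorAlgebra 𝔽 V) :
    ExteriorAlgebra 𝔽 V ⊗[𝔽] ExteriorAlgebra 𝔽 V →ₗ[𝔽]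
      ExteriorAlgebra 𝔽 V ⊗[𝔽] ExteriorAlgebra 𝔽 V :=
  TensorProduct.lift (mulL.compl₂ (rho b p t ∘ₗ (TensorProduct.mk 𝔽 _ _).flip z))

theorem rhoAct_tmul (b : Module.Basis ι 𝔽 V) (p t : 𝔽) (z a x : ExteriorAlgebra 𝔽 V) :
    rhoAct b p t z (a ⊗ₜ[𝔽] x) = mulL a (rho b p t (x ⊗ₜ[𝔽] z)) := rfl

theorem mulL_mul (x y : ExteriorAlgebra 𝔽 V) (z : ExteriorAlgebra 𝔽 V ⊗[𝔽] ExteriorAlgebra 𝔽 V) :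
    mulL (x * y) z = mulL x (mulL y z) := by
  induction z using TensorProduct.induction_on with
  | zero => simp
  | tmul a c => simp [mul_assoc]
  | add z z' h h' => simp only [map_add, h, h']

theorem mulL_one (z : ExteriorAlgebra 𝔽 V ⊗[𝔽] ExteriorAlgebra 𝔽 V) : mulL 1 z = z := by
  induction z using TensorProduct.induction_on with
  | zero => simp
  | tmul a c => simp
  | add z z' h h' => simp only [map_add, h, h']

theorem rhoAct_mulL (b : Module.Basis ι 𝔽 V) (p t : 𝔽) (z a : ExteriorAlgebra 𝔽 V)
    (s : ExteriorAlgebra 𝔽 V ⊗[𝔽] ExteriorAlgebra 𝔽 V) :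
    rhoAct b p t z (mulL a s) = mulL a (rhoAct b p t z s) := by
  induction s using TensorProduct.induction_on with
  | zero => simp
  | tmul x y => rw [mulL_tmul, rhoAct_tmul, rhoAct_tmul, mulL_mul]
  | add z z' h h' => simp only [map_add, h, h']

/-- By `rho_tmul_ι` the right-hand side is `rhoAct y (ρ(x ⊗ v))`: this is multiplicativity for a
product whose first factor is a vector, from which the general case follows by induction. -/
theorem rho_tmul_ι_mul (b : Module.Basis ι 𝔽 V) (p t : 𝔽) (v : V) (x y : ExteriorAlgebra 𝔽 V) :
    rho b p t (x ⊗ₜ[𝔽] (ExteriorAlgebra.ι 𝔽 v * y)) =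
      t • rhoAct b p t y (braid b p (x ⊗ₜ[𝔽] ExteriorAlgebra.ι 𝔽 v)) +
        rho b p t (((x - t • diagAut p x) * ExteriorAlgebra.ι 𝔽 v) ⊗ₜ[𝔽] y) := by
  rw [rho_tmul, comul_ι_mul, map_add, rhoAux_leftGen, rhoAux_rightGen, ← rho_tmul]
  have h : (rhoAux b p t).flip (comul b p y) =
      rho b p t ∘ₗ (TensorProduct.mk 𝔽 _ _).flip y :=
    LinearMap.ext fun u => (rho_tmul b p t u y).symm
  rw [h]
  rfl

theorem rho_tmul_ι (b : Module.Basis ι 𝔽 V) (p t : 𝔽) (v : V) (x : ExteriorAlgebra 𝔽 V) :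
    rho b p t (x ⊗ₜ[𝔽] ExteriorAlgebra.ι 𝔽 v) =
      t • braid b p (x ⊗ₜ[𝔽] ExteriorAlgebra.ι 𝔽 v) +
        1 ⊗ₜ[𝔽] ((x - t • diagAut p x) * ExteriorAlgebra.ι 𝔽 v) := by
  have h := rho_tmul_ι_mul b p t v x 1
  have h1 : rhoAct b p t 1 = LinearMap.id := by
    ext a x
    simp [rhoAct_tmul, rho_tmul_one]
  rwa [mul_one, rho_tmul_one, h1] at h

/-- The `R`-matrix is multiplicative in its second argument:
`ρ(id ⊗ ∇) = (∇ ⊗ id)(id ⊗ ρ)(ρ ⊗ id)`. -/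
theorem rho_tmul_mul (b : Module.Basis ι 𝔽 V) (p t : 𝔽) (x y z : ExteriorAlgebra 𝔽 V) :
    rho b p t (x ⊗ₜ[𝔽] (y * z)) = rhoAct b p t z (rho b p t (x ⊗ₜ[𝔽] y)) := by
  induction y using induction_left b generalizing x with
  | h1 => rw [one_mul, rho_tmul_one, rhoAct_tmul, mulL_one]
  | hadd u w hu hw => simp only [add_mul, TensorProduct.tmul_add, map_add, hu, hw]
  | hsmul c u hu => simp only [smul_mul_assoc, TensorProduct.tmul_smul, map_smul, hu]
  | hmul k u hu =>
    have h1 : ∀ s, rhoAct b p t (u * z) s = rhoAct b p t z (rhoAct b p t u s) := by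
      intro s
      induction s using TensorProduct.induction_on with
      | zero => simp
      | tmul a c => rw [rhoAct_tmul, rhoAct_tmul, rhoAct_mulL, hu]
      | add s s' h h' => simp only [map_add, h, h']
    rw [mul_assoc, rho_tmul_ι_mul, rho_tmul_ι_mul, h1, hu, map_add, map_smul]

/-! ### Inversion counts. -/

theorem thetaSet_empty_left (B : Finset ι) : thetaSet ∅ B = 0 := rfl

theorem thetaSet_empty_right (A : Finset ι) : thetaSet A ∅ = 0 := by simp [thetaSet]

theorem thetaSet_union_left {A B : Finset ι} (h : Disjoint A B) (C : Finset ι) :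
    thetaSet (A ∪ B) C = thetaSet A C + thetaSet B C :=
  Finset.sum_union h

theorem thetaSet_union_right (A : Finset ι) {B C : Finset ι} (h : Disjoint B C) :
    thetaSet A (B ∪ C) = thetaSet A B + thetaSet A C := by
  simp only [thetaSet, Finset.sum_union h, Finset.sum_add_distrib]

theorem thetaSet_insert_left {a : ι} {A : Finset ι} (h : a ∉ A) (C : Finset ι) :
    thetaSet (insert a A) C = thetaSet {a} C + thetaSet A C := by
  rw [Finset.insert_eq, thetaSet_union_left (Finset.disjoint_singleton_left.2 h)]

theorem thetaSet_insert_right (A : Finset ι) {c : ι} {C : Finset ι} (h : c ∉ C) :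
    thetaSet A (insert c C) = thetaSet A {c} + thetaSet A C := by
  rw [Finset.insert_eq, thetaSet_union_right _ (Finset.disjoint_singleton_left.2 h)]

theorem thetaSet_singleton (a c : ι) : thetaSet {a} {c} = theta a c := by simp [thetaSet]

theorem thetaSet_eq_zero {A C : Finset ι} (h : ∀ a ∈ A, ∀ c ∈ C, a ≤ c) : thetaSet A C = 0 :=
  Finset.sum_eq_zero fun a ha => Finset.sum_eq_zero fun c hc => if_neg (h a ha c hc).not_gt

theorem thetaSet_singleton_eq_card {a : ι} {C : Finset ι} (h : ∀ c ∈ C, c < a) :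
    thetaSet {a} C = C.card := by
  rw [thetaSet, Finset.sum_singleton, Finset.card_eq_sum_ones]
  exact Finset.sum_congr rfl fun c hc => theta_of_gt (h c hc)

theorem thetaSet_singleton_add {a : ι} {C : Finset ι} (h : a ∉ C) :
    thetaSet {a} C + thetaSet C {a} = C.card := by
  rw [thetaSet, thetaSet, Finset.sum_singleton, Finset.card_eq_sum_ones, ← Finset.sum_add_distrib]
  refine Finset.sum_congr rfl fun c hc => ?_
  rw [Finset.sum_singleton]
  rcases lt_or_gt_of_ne (ne_of_mem_of_not_mem hc h) with h | h <;>
    rw [theta_of_lt h, theta_of_gt h]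

theorem thetaSet_singleton_le (a : ι) (C : Finset ι) : thetaSet {a} C ≤ C.card := by
  rw [thetaSet, Finset.sum_singleton, Finset.card_eq_sum_ones]
  refine Finset.sum_le_sum fun c _ => ?_
  unfold theta
  split_ifs <;> simp

/-! ### Ordered monomials and their braiding with a basis vector. -/

theorem setBasis_eq_prod (b : Module.Basis ι 𝔽 V) (E : Finset ι) :
    setBasis b E = (E.sort.map fun i => ExteriorAlgebra.ι 𝔽 (b i)).prod := by
  rw [setBasis, ExteriorAlgebra.basis_apply_ofCard b (rfl : E.card = E.card),
    ExteriorAlgebra.ιMulti_family, ExteriorAlgebra.ιMulti_apply]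
  congr 1
  refine List.ext_getElem (by simp) fun n h h' => ?_
  rw [List.getElem_ofFn, List.getElem_map]
  rfl

theorem setBasis_empty (b : Module.Basis ι 𝔽 V) : setBasis b ∅ = 1 := by
  simp [setBasis_eq_prod]

theorem setBasis_insert_of_lt (b : Module.Basis ι 𝔽 V) {a : ι} {E : Finset ι}
    (h : ∀ c ∈ E, a < c) : setBasis b (insert a E) = ExteriorAlgebra.ι 𝔽 (b a) * setBasis b E := by
  rw [setBasis_eq_prod, setBasis_eq_prod,
    Finset.sort_insert _ (fun c hc => (h c hc).le) fun ha => lt_irrefl _ (h a ha),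
    List.map_cons, List.prod_cons]

theorem setBasis_singleton (b : Module.Basis ι 𝔽 V) (a : ι) :
    setBasis b {a} = ExteriorAlgebra.ι 𝔽 (b a) := by
  rw [← insert_empty_eq, setBasis_insert_of_lt b (by simp), setBasis_empty, mul_one]

theorem ι_mul_setBasis (b : Module.Basis ι 𝔽 V) {a : ι} {E : Finset ι} (h : a ∉ E) :
    ExteriorAlgebra.ι 𝔽 (b a) * setBasis b E =
      (-1 : 𝔽) ^ thetaSet {a} E • setBasis b (insert a E) := by
  induction E using Finset.induction_on_min with
  | empty => rw [setBasis_insert_of_lt b (by simp), thetaSet_empty_right, pow_zero, one_smul]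
  | insert k E hk ih =>
    rw [Finset.mem_insert, not_or] at h
    rcases lt_or_gt_of_ne h.1 with hak | hka
    · have hlt : ∀ c ∈ insert k E, a < c := by
        intro c hc
        rcases Finset.mem_insert.1 hc with rfl | hc
        exacts [hak, hak.trans (hk c hc)]
      rw [setBasis_insert_of_lt b hlt, thetaSet_eq_zero (by simpa using ⟨hak.le, fun c hc => (hlt c
        (Finset.mem_insert_of_mem hc)).le⟩), pow_zero, one_smul]
    · have hlt : ∀ c ∈ insert a E, k < c := by
        intro c hc
        rcases Finset.mem_insert.1 hc with rfl | hc
        exacts [hka, hk c hc]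
      rw [setBasis_insert_of_lt b hk, ← mul_assoc, ι_mul_swap, neg_mul, mul_assoc, ih h.2,
        mul_smul_comm, ← setBasis_insert_of_lt b hlt, Finset.insert_comm,
        thetaSet_insert_right _ fun hkE => lt_irrefl _ (hk k hkE), thetaSet_singleton,
        theta_of_gt hka, pow_add, pow_one, neg_one_mul, neg_smul]

theorem ι_mul_setBasis_of_mem (b : Module.Basis ι 𝔽 V) {a : ι} {E : Finset ι} (h : a ∈ E) :
    ExteriorAlgebra.ι 𝔽 (b a) * setBasis b E = 0 := by
  have h1 := ι_mul_setBasis b (Finset.notMem_erase a E)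
  rw [Finset.insert_erase h] at h1
  have h2 : setBasis b E = (-1 : 𝔽) ^ thetaSet {a} (E.erase a) •
      (ExteriorAlgebra.ι 𝔽 (b a) * setBasis b (E.erase a)) := by
    rw [h1, smul_smul, ← mul_pow, neg_one_mul, neg_neg, one_pow, one_smul]
  rw [h2, mul_smul_comm, ← mul_assoc, ExteriorAlgebra.ι_sq_zero, zero_mul, smul_zero]

theorem setBasis_mul (b : Module.Basis ι 𝔽 V) {A B : Finset ι} (h : Disjoint A B) :
    setBasis b A * setBasis b B = (-1 : 𝔽) ^ thetaSet A B • setBasis b (A ∪ B) := by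
  induction A using Finset.induction_on_min with
  | empty => simp [setBasis_empty, thetaSet_empty_left]
  | insert k A hk ih =>
    rw [Finset.disjoint_insert_left] at h
    have hkA : k ∉ A := fun hkA => lt_irrefl _ (hk k hkA)
    rw [setBasis_insert_of_lt b hk, mul_assoc, ih h.2, mul_smul_comm, ι_mul_setBasis b
      (by simp [hkA, h.1]), smul_smul, ← pow_add, Finset.insert_union, thetaSet_insert_left hkA,
      thetaSet_union_right _ h.2, thetaSet_eq_zero (A := {k}) (C := A)
        (by simpa using fun c hc => (hk c hc).le), zero_add, add_comm]

theorem setBasis_mul_of_not_disjoint (b : Module.Basis ι 𝔽 V) {A B : Finset ι}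
    (h : ¬ Disjoint A B) : setBasis b A * setBasis b B = 0 :=
  ExteriorAlgebra.basis_mul_of_not_disjoint b (Set.powersetCard.ofCard (s := A) rfl)
    (Set.powersetCard.ofCard (s := B) rfl) h

theorem setBasis_insert_of_gt (b : Module.Basis ι 𝔽 V) {a : ι} {E : Finset ι}
    (h : ∀ c ∈ E, c < a) : setBasis b (insert a E) = setBasis b E * ExteriorAlgebra.ι 𝔽 (b a) := by
  rw [← setBasis_singleton, setBasis_mul b (Finset.disjoint_singleton_right.2
    fun ha => lt_irrefl _ (h a ha)), thetaSet_eq_zero (by simpa using fun c hc => (h c hc).le),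
    pow_zero, one_smul, Finset.union_comm, ← Finset.insert_eq]

theorem setBasis_mul_ι (b : Module.Basis ι 𝔽 V) {a : ι} {E : Finset ι} (h : a ∉ E) :
    setBasis b E * ExteriorAlgebra.ι 𝔽 (b a) =
      (-1 : 𝔽) ^ thetaSet E {a} • setBasis b (insert a E) := by
  rw [← setBasis_singleton, setBasis_mul b (Finset.disjoint_singleton_right.2 h),
    Finset.union_comm, ← Finset.insert_eq]

theorem diagAut_setBasis (b : Module.Basis ι 𝔽 V) (c : 𝔽) (E : Finset ι) :
    diagAut c (setBasis b E) = c ^ E.card • setBasis b E := by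
  induction E using Finset.induction_on_min with
  | empty => simp [setBasis_empty]
  | insert k E hk ih =>
    rw [setBasis_insert_of_lt b hk, diagAut_ι_mul, ih, mul_smul_comm, smul_smul,
      Finset.card_insert_of_notMem fun hkE => lt_irrefl _ (hk k hkE), pow_succ']

theorem rightGen_basis_tmul (b : Module.Basis ι 𝔽 V) (p : 𝔽) (k a : ι) (y : ExteriorAlgebra 𝔽 V) :
    rightGen b p (b k) (ExteriorAlgebra.ι 𝔽 (b a) ⊗ₜ[𝔽] y) =
      (p ^ theta k a - 1) •
          (ExteriorAlgebra.ι 𝔽 (b k) ⊗ₜ[𝔽] (ExteriorAlgebra.ι 𝔽 (b a) * y)) -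
        p ^ theta a k • (ExteriorAlgebra.ι 𝔽 (b a) ⊗ₜ[𝔽] (ExteriorAlgebra.ι 𝔽 (b k) * y)) := by
  rw [rightGen_ι_tmul, hecke_basis]
  simp

/-- The elements of `E` braid past `i` starting from the largest. Since `τ(k ⊗ i)` has an unswapped
term only for `k > i`, the carried index is `i` until it is replaced by some `a > i`; the elements
still to come are below `a`, so no second replacement occurs. -/
theorem braid_setBasis_tmul_ι (b : Module.Basis ι 𝔽 V) (p : 𝔽) (E : Finset ι) (i : ι) :
    braid b p (setBasis b E ⊗ₜ[𝔽] ExteriorAlgebra.ι 𝔽 (b i)) =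
      (-1 : 𝔽) ^ E.card • (p ^ thetaSet {i} E • (ExteriorAlgebra.ι 𝔽 (b i) ⊗ₜ[𝔽] setBasis b E) -
        (p - 1) • ∑ a ∈ E with i < a, (-p) ^ thetaSet {a} E • (ExteriorAlgebra.ι 𝔽 (b a) ⊗ₜ[𝔽]
          (ExteriorAlgebra.ι 𝔽 (b i) * setBasis b (E.erase a)))) := by
  induction E using Finset.induction_on_min with
  | empty => simp [setBasis_empty, braid_one_tmul, thetaSet_empty_right]
  | insert k E hk ih =>
    have hkE : k ∉ E := fun hkE => lt_irrefl _ (hk k hkE)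
    -- An index `a` carried so far lies above the new minimum `k`, so `τ(k ⊗ a) = -p a ⊗ k` has a
    -- single term. One sign is absorbed by moving `b k` past `b i`.
    have key : ∑ a ∈ E with i < a, (-p) ^ thetaSet {a} (insert k E) •
        (ExteriorAlgebra.ι 𝔽 (b a) ⊗ₜ[𝔽]
          (ExteriorAlgebra.ι 𝔽 (b i) * setBasis b ((insert k E).erase a))) =
        -rightGen b p (b k) (∑ a ∈ E with i < a, (-p) ^ thetaSet {a} E •
          (ExteriorAlgebra.ι 𝔽 (b a) ⊗ₜ[𝔽]
            (ExteriorAlgebra.ι 𝔽 (b i) * setBasis b (E.erase a)))) := by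
      rw [map_sum, ← Finset.sum_neg_distrib]
      refine Finset.sum_congr rfl fun a ha => ?_
      have haE := (Finset.mem_filter.1 ha).1
      have hka := hk a haE
      rw [map_smul, rightGen_basis_tmul, theta_of_lt hka, theta_of_gt hka,
        thetaSet_insert_right _ hkE, thetaSet_singleton, theta_of_gt hka,
        Finset.erase_insert_of_ne hka.ne, setBasis_insert_of_lt b
          fun c hc => hk c (Finset.mem_of_mem_erase hc), ← mul_assoc, ι_mul_swap (b i) (b k),
        neg_mul, mul_assoc]
      simp only [TensorProduct.tmul_neg, pow_zero, sub_self, zero_smul, pow_one]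
      module
    rw [setBasis_insert_of_lt b hk, braid_ι_mul, ih, map_smul, map_sub, map_smul, map_smul,
      rightGen_basis_tmul, Finset.card_insert_of_notMem hkE, Finset.filter_insert,
      thetaSet_insert_right _ hkE, thetaSet_singleton]
    -- Only for `i < k` does the sum gain a term, the one with `a = k`; its exponent `θ_{k,E}` is
    -- zero as `k` is minimal.
    rcases lt_trichotomy i k with h | rfl | h
    · rw [if_pos h, Finset.sum_insert (by simp [hkE]), key, thetaSet_insert_right _ hkE,
        thetaSet_singleton, theta_self, thetaSet_eq_zero (A := {k}) (C := E)
          (by simpa using fun c hc => (hk c hc).le), thetaSet_eq_zero (A := {i}) (C := E)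
          (by simpa using fun c hc => (h.trans (hk c hc)).le), Finset.erase_insert hkE,
        theta_of_lt h, theta_of_gt h]
      module
    · rw [if_neg (lt_irrefl _), key, theta_self]
      module
    · rw [if_neg h.not_gt, key, theta_of_lt h, theta_of_gt h]
      module

/-! ### The coefficients `α`. -/

theorem alpha_congr (p : 𝔽) {G H H' : Finset ι}
    (h : ∀ a ∈ G, thetaSet {a} H = thetaSet {a} H') : alpha p G H = alpha p G H' :=
  Finset.prod_congr rfl fun a ha => by rw [h a ha]

theorem alpha_insert_of_gt (p : 𝔽) {g : ι} {G : Finset ι} (hg : ∀ a ∈ G, a < g) (H : Finset ι) :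
    alpha p (insert g G) H =
      (p ^ ((thetaSet {g} H : ℤ) - (G.card : ℤ)) - 1) * alpha p G H := by
  have hgG : g ∉ G := fun h => lt_irrefl _ (hg g h)
  rw [alpha, Finset.prod_insert hgG, thetaSet_insert_right _ hgG, thetaSet_singleton, theta_self,
    zero_add, thetaSet_singleton_eq_card hg]
  congr 1
  refine Finset.prod_congr rfl fun a ha => ?_
  rw [thetaSet_insert_right _ hgG, thetaSet_singleton, theta_of_lt (hg a ha), zero_add]

/-- Remove the largest element `g` of `G`, leaving at least `|H|` elements. If all of `H` lies below
`g` and `|H|` equals the number left, the factor of `g` is `p^0 - 1 = 0`. Otherwise fewer elements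
of `H` lie below `g` than are left in `G`, and the remaining factors see only those, so induction
applies. -/
theorem alpha_eq_zero (p : 𝔽) {G H : Finset ι} (h : H.card < G.card) : alpha p G H = 0 := by
  induction G using Finset.induction_on_max generalizing H with
  | empty => simp at h
  | insert g G hg ih =>
    rw [Finset.card_insert_of_notMem fun h => lt_irrefl _ (hg g h), Nat.lt_succ_iff] at h
    have hH : thetaSet {g} H = (H.filter (· < g)).card := by
      simp [thetaSet, theta]
    rw [alpha_insert_of_gt p hg]
    rcases (thetaSet_singleton_le g H).trans h |>.lt_or_eq with hlt | heq
    · rw [alpha_congr p (H' := H.filter (· < g)), ih (hH ▸ hlt), mul_zero]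
      intro a ha
      simp only [thetaSet, Finset.sum_singleton, Finset.sum_filter]
      refine Finset.sum_congr rfl fun c _ => ?_
      unfold theta
      have := hg a ha
      split_ifs <;> first | rfl | (exfalso; order)
    · rw [heq, sub_self, zpow_zero, sub_self, zero_mul]

/-- This is the identity behind the recursion for the coefficients of `ρ`. Only the factors of `a >
i` change. Put `q = p^(|H| - |G|)` and let `S` be the sum for `G`. Adjoining a new maximum `g > i`
to `G` reduces the claim to `(pq - 1)(α + (p - 1)S) = (q - 1)α + (p - 1)(qα + (pq - 1)S)`. -/
theorem alpha_insert_right {p : 𝔽} (hp : p ≠ 0) {i : ι} {G H : Finset ι} (hH : ∀ c ∈ H, c < i)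
    (hG : i ∉ G) :
    alpha p G (insert i H) = alpha p G H +
      (p - 1) * ∑ a ∈ G with i < a, p ^ ((H.card : ℤ) - (thetaSet {a} G : ℤ)) *
        alpha p (G.erase a) H := by
  have hiH : i ∉ H := fun h => lt_irrefl _ (hH i h)
  induction G using Finset.induction_on_max with
  | empty => simp [alpha]
  | insert g G hg ih =>
    have hgG : g ∉ G := fun h => lt_irrefl _ (hg g h)
    rw [Finset.mem_insert, not_or] at hG
    rcases lt_or_gt_of_ne hG.1 with h | h
    · have hHg : ∀ c ∈ H, c < g := fun c hc => (hH c hc).trans h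
      -- Erasing `a` lowers by one the number of elements of `G` below `g`, hence the `+ 1` in the
      -- factor of `g`.
      have hsum : ∑ a ∈ G with i < a, p ^ ((H.card : ℤ) - (thetaSet {a} (insert g G) : ℤ)) *
          alpha p ((insert g G).erase a) H = (p ^ ((H.card : ℤ) - (G.card : ℤ) + 1) - 1) *
            ∑ a ∈ G with i < a, p ^ ((H.card : ℤ) - (thetaSet {a} G : ℤ)) *
              alpha p (G.erase a) H := by
        rw [Finset.mul_sum]
        refine Finset.sum_congr rfl fun a ha => ?_
        have haG := (Finset.mem_filter.1 ha).1
        have hag := hg a haG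
        rw [Finset.erase_insert_of_ne hag.ne', alpha_insert_of_gt p
          fun c hc => hg c (Finset.mem_of_mem_erase hc), thetaSet_singleton_eq_card hHg,
          thetaSet_insert_right _ hgG, thetaSet_singleton, theta_of_lt hag, zero_add,
          Finset.card_erase_of_mem haG, Nat.cast_sub (Finset.card_pos.2 ⟨a, haG⟩), Nat.cast_one,
          sub_sub_eq_add_sub, add_sub_right_comm]
        ring
      rw [alpha_insert_of_gt p hg, alpha_insert_of_gt p hg, Finset.filter_insert, if_pos h,
        Finset.sum_insert (by simp [hgG]), hsum, Finset.erase_insert hgG, ih hG.2,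
        thetaSet_insert_right _ hiH, thetaSet_insert_right _ hgG, thetaSet_singleton,
        thetaSet_singleton, theta_of_gt h, theta_self, zero_add, thetaSet_singleton_eq_card hHg,
        thetaSet_singleton_eq_card hg, Nat.cast_add, Nat.cast_one, add_comm (1 : ℤ),
        add_sub_right_comm, zpow_add_one₀ hp]
      ring
    · rw [Finset.filter_false_of_mem, Finset.sum_empty, mul_zero, add_zero]
      · refine alpha_congr p fun a ha => ?_
        rw [thetaSet_insert_right _ hiH, thetaSet_singleton, theta_of_lt, zero_add]
        rcases Finset.mem_insert.1 ha with rfl | ha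
        exacts [h, (hg a ha).trans h]
      · intro a ha
        rcases Finset.mem_insert.1 ha with rfl | ha
        exacts [h.not_gt, ((hg a ha).trans h).not_gt]

/-! ### One generator acting on a signed tensor. -/

theorem neg_one_pow_congr_mod {m n : ℕ} (h : m % 2 = n % 2) : (-1 : 𝔽) ^ m = (-1) ^ n := by
  rw [neg_one_pow_eq_pow_mod_two, h, ← neg_one_pow_eq_pow_mod_two]

theorem thetaSet_add_thetaSet {A B : Finset ι} (h : Disjoint A B) :
    thetaSet A B + thetaSet B A = A.card * B.card := by
  induction A using Finset.induction_on with
  | empty => simp [thetaSet_empty_left, thetaSet_empty_right]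
  | insert a A ha ih =>
    rw [Finset.disjoint_insert_left] at h
    rw [thetaSet_insert_left ha, thetaSet_insert_right _ ha, Finset.card_insert_of_notMem ha,
      add_mul, ← ih h.2, one_mul, ← thetaSet_singleton_add h.1]
    ring

/-- `(-1)^θ_{A,B} f_A ⊗ f_B`, whose product is `f_{A ⊔ B}`. -/
def signedTensor (b : Module.Basis ι 𝔽 V) (A B : Finset ι) :
    ExteriorAlgebra 𝔽 V ⊗[𝔽] ExteriorAlgebra 𝔽 V :=
  (-1 : 𝔽) ^ thetaSet A B • (setBasis b A ⊗ₜ[𝔽] setBasis b B)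

theorem rho_setBasis_tmul_ι (b : Module.Basis ι 𝔽 V) (p t : 𝔽) (E : Finset ι) (i : ι) :
    rho b p t (setBasis b E ⊗ₜ[𝔽] ExteriorAlgebra.ι 𝔽 (b i)) =
      (t * (-1) ^ E.card * p ^ thetaSet {i} E) •
          (ExteriorAlgebra.ι 𝔽 (b i) ⊗ₜ[𝔽] setBasis b E) +
        (1 - t * p ^ E.card) • (1 ⊗ₜ[𝔽] (setBasis b E * ExteriorAlgebra.ι 𝔽 (b i))) -
        ∑ a ∈ E with i < a, (t * (-1) ^ E.card * (p - 1) * (-p) ^ thetaSet {a} E) •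
          (ExteriorAlgebra.ι 𝔽 (b a) ⊗ₜ[𝔽]
            (ExteriorAlgebra.ι 𝔽 (b i) * setBasis b (E.erase a))) := by
  have h : setBasis b E - t • diagAut p (setBasis b E) = (1 - t * p ^ E.card) • setBasis b E := by
    rw [diagAut_setBasis]
    module
  rw [rho_tmul_ι, braid_setBasis_tmul_ι, h, smul_mul_assoc, TensorProduct.tmul_smul]
  simp only [mul_smul _ _ (_ ⊗ₜ[𝔽] (_ * setBasis b (Finset.erase _ _))), ← Finset.smul_sum]
  module

/-- All terms have the same union `A ∪ B ∪ {i}`. With the normalization of `signedTensor`, the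
common sign is the one in `f_{A ∪ B} v_i = ± f_{A ∪ B ∪ {i}}`, so it does not depend on how the
union is split. -/
theorem rhoAct_signedTensor (b : Module.Basis ι 𝔽 V) (p t : 𝔽) {A B : Finset ι} {i : ι}
    (h : Disjoint A B) (hA : i ∉ A) (hB : i ∉ B) :
    rhoAct b p t (ExteriorAlgebra.ι 𝔽 (b i)) (signedTensor b A B) =
      (-1 : 𝔽) ^ thetaSet (A ∪ B) {i} •
        ((t * p ^ thetaSet {i} B) • signedTensor b (insert i A) B +
          (1 - t * p ^ B.card) • signedTensor b A (insert i B) +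
          ∑ a ∈ B with i < a, (t * (p - 1) * p ^ thetaSet {a} B) •
            signedTensor b (insert a A) (insert i (B.erase a))) := by
  have hU := thetaSet_union_left h {i}
  rw [signedTensor, map_smul, rhoAct_tmul, rho_setBasis_tmul_ι, map_sub, map_add, map_smul,
    map_smul, map_sum, mulL_tmul, mulL_tmul, mul_one, setBasis_mul_ι b hA, setBasis_mul_ι b hB,
    smul_sub, smul_add, smul_add, smul_add, sub_eq_add_neg]
  congr 1
  · congr 1
    · have hs := thetaSet_singleton_add hB
      have e := neg_one_pow_congr_mod (𝔽 := 𝔽) (m := thetaSet A B + B.card + thetaSet A {i})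
        (n := thetaSet (A ∪ B) {i} + thetaSet (insert i A) B)
        (by rw [thetaSet_insert_left hA]; omega)
      rw [pow_add, pow_add, pow_add] at e
      rw [signedTensor, ← TensorProduct.smul_tmul']
      simp only [smul_smul]
      congr 1
      linear_combination (t * p ^ thetaSet {i} B) * e
    · have e := neg_one_pow_congr_mod (𝔽 := 𝔽) (m := thetaSet A B + thetaSet B {i})
        (n := thetaSet (A ∪ B) {i} + thetaSet A (insert i B))
        (by rw [thetaSet_insert_right _ hB]; omega)
      rw [pow_add, pow_add] at e
      rw [signedTensor, TensorProduct.tmul_smul]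
      simp only [smul_smul]
      congr 1
      linear_combination (1 - t * p ^ B.card) * e
  · rw [← smul_neg, ← Finset.sum_neg_distrib, Finset.smul_sum, Finset.smul_sum]
    refine Finset.sum_congr rfl fun a ha => ?_
    obtain ⟨haB, hia⟩ := Finset.mem_filter.1 ha
    have haA : a ∉ A := Finset.disjoint_right.1 h haB
    have hiB : i ∉ B.erase a := fun hi => hB (Finset.mem_of_mem_erase hi)
    have haE := Finset.notMem_erase a B
    rw [map_smul, mulL_tmul, setBasis_mul_ι b haA, ι_mul_setBasis b hiB, signedTensor,
      ← TensorProduct.smul_tmul', TensorProduct.tmul_smul]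
    -- Parity count for the exchange of `a` and `i`. The `1` is the minus sign in front of the sum,
    -- and `θ_{a,i} = 1` as `i < a`.
    have e := neg_one_pow_congr_mod (𝔽 := 𝔽)
      (m := thetaSet A B + B.card + thetaSet {a} B + 1 + thetaSet A {a} + thetaSet {i} (B.erase a))
      (n := thetaSet (A ∪ B) {i} + thetaSet (insert a A) (insert i (B.erase a))) (by
        have h1 := thetaSet_insert_right A haE
        have h2 := thetaSet_insert_right {a} haE
        have h3 := thetaSet_insert_left haE {i}
        rw [Finset.insert_erase haB, thetaSet_singleton] at *
        rw [theta_self] at h2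
        rw [theta_of_gt hia] at h3
        have h4 := thetaSet_singleton_add hiB
        have h5 := Finset.card_erase_add_one haB
        rw [thetaSet_insert_left haA, thetaSet_insert_right _ hiB, thetaSet_insert_right _ hiB,
          thetaSet_singleton, theta_of_gt hia]
        omega)
    simp only [pow_add, pow_one] at e
    simp only [smul_smul, ← neg_smul]
    congr 1
    rw [neg_pow p]
    linear_combination (t * (p - 1) * p ^ thetaSet {a} B) * e

/-- Reindexes the exchanges by the set `G ∪ {a}` that they lead to instead of the set `G` that they
start from, so that terms with equal basis tensors can be collected. -/
theorem sum_powerset_sum_sdiff {M : Type*} [AddCommMonoid M] (E : Finset ι) (P : ι → Prop)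
    [DecidablePred P] (f : Finset ι → ι → M) :
    ∑ G ∈ E.powerset, ∑ a ∈ E \ G with P a, f G a =
      ∑ G ∈ E.powerset, ∑ a ∈ G with P a, f (G.erase a) a := by
  rw [Finset.sum_sigma', Finset.sum_sigma']
  refine Finset.sum_bij' (fun x _ => ⟨insert x.2 x.1, x.2⟩) (fun x _ => ⟨x.1.erase x.2, x.2⟩)
    ?_ ?_ ?_ ?_ ?_
  · rintro ⟨G, a⟩ h
    simp only [Finset.mem_sigma, Finset.mem_powerset, Finset.mem_filter, Finset.mem_sdiff] at h ⊢
    exact ⟨Finset.insert_subset h.2.1.1 h.1, Finset.mem_insert_self _ _, h.2.2⟩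
  · rintro ⟨G, a⟩ h
    simp only [Finset.mem_sigma, Finset.mem_powerset, Finset.mem_filter, Finset.mem_sdiff] at h ⊢
    exact ⟨(Finset.erase_subset _ _).trans h.1, ⟨h.1 h.2.1, Finset.notMem_erase _ _⟩, h.2.2⟩
  · rintro ⟨G, a⟩ h
    simp only [Finset.mem_sigma, Finset.mem_filter, Finset.mem_sdiff] at h
    simp [Finset.erase_insert h.2.1.2]
  · rintro ⟨G, a⟩ h
    simp only [Finset.mem_sigma, Finset.mem_filter] at h
    simp [Finset.insert_erase h.2.1]
  · rintro ⟨G, a⟩ h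
    simp only [Finset.mem_sigma, Finset.mem_filter, Finset.mem_sdiff] at h
    simp [Finset.erase_insert h.2.1.2]

/-! ### Disjoint sets: the recursion for the coefficients and its solution. -/

/-- The coefficient of `ρ` on disjoint sets `E` and `D`, up to signs. -/
def disjointCoeff (p t : 𝔽) (E G D H : Finset ι) : 𝔽 :=
  t ^ (exchange D H G).card * pochhammer (t * p ^ E.card) p (H.card - G.card) *
    (p ^ (thetaSet G E + thetaSet (D \ H) (exchange E G H)) * alpha p G H)

/-- The pair `(G, H ∪ {i})` is reached from `(G, H)` by moving `i` directly, or from `(G \ {a}, H)`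
by letting `i` displace `a`. The direct move adds a Pochhammer factor, and the displacements add up
to the sum in `alpha_insert_right`. -/
theorem disjointCoeff_insert {p : 𝔽} (hp : p ≠ 0) (t : 𝔽) {E D G H : Finset ι} {i : ι}
    (hED : Disjoint E D) (hD : ∀ c ∈ D, c < i) (hE : i ∉ E) (hG : G ⊆ E) (hH : H ⊆ D) :
    disjointCoeff p t E G (insert i D) (insert i H) =
      (1 - t * p ^ (exchange E G H).card) * disjointCoeff p t E G D H +
        ∑ a ∈ G with i < a, t * (p - 1) * p ^ thetaSet {a} (exchange E (G.erase a) H) *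
          disjointCoeff p t E (G.erase a) D H := by
  have hiD : i ∉ D := fun h => lt_irrefl _ (hD i h)
  have hiH : i ∉ H := fun h => hiD (hH h)
  have hiG : i ∉ G := fun h => hE (hG h)
  have hGD : ∀ {G' : Finset ι}, G' ⊆ E → Disjoint (D \ H) G' := fun h =>
    (hED.symm.mono_right h).mono_left Finset.sdiff_subset
  have hEH : Disjoint (E \ G) H := (hED.mono_right hH).mono_left Finset.sdiff_subset
  have hiB : i ∉ exchange E G H := by simp [exchange, hE, hiH]
  have hDi : insert i D \ insert i H = D \ H := by
    ext c
    simp only [Finset.mem_sdiff, Finset.mem_insert]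
    constructor
    · rintro ⟨rfl | h1, h2⟩ <;> tauto
    · exact fun h => ⟨Or.inr h.1, fun h' => h'.elim (fun e => hiD (e ▸ h.1)) h.2⟩
  have hA : exchange (insert i D) (insert i H) G = exchange D H G := by rw [exchange, hDi, exchange]
  have hB : exchange E G (insert i H) = insert i (exchange E G H) := by
    rw [exchange, exchange, Finset.union_insert]
  -- Every element of `D` is below `i`, so adding to `E'` an element that is at least `i` creates no
  -- inversions with `D \ H`.
  have hY : ∀ {a : ι} {B : Finset ι}, a ∉ B → (i ≤ a) →
      thetaSet (D \ H) (insert a B) = thetaSet (D \ H) B := by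
    intro a B ha hia
    rw [thetaSet_insert_right _ ha, thetaSet_eq_zero (by
      simpa using fun c hc _ => ((hD c hc).trans_le hia).le), zero_add]
  have hcardA : ∀ {G' : Finset ι}, G' ⊆ E → (exchange D H G').card = (D \ H).card + G'.card :=
    fun h => Finset.card_union_of_disjoint (hGD h)
  have hcardB : (exchange E G H).card + G.card = E.card + H.card := by
    rw [exchange, Finset.card_union_of_disjoint hEH, add_right_comm,
      Finset.card_sdiff_add_card_eq_card hG]
  have hsum : ∑ a ∈ G with i < a, t * (p - 1) * p ^ thetaSet {a} (exchange E (G.erase a) H) *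
      disjointCoeff p t E (G.erase a) D H = t ^ (exchange D H G).card *
        pochhammer (t * p ^ E.card) p ((insert i H).card - G.card) *
        p ^ (thetaSet G E + thetaSet (D \ H) (exchange E G H)) *
        ((p - 1) * ∑ a ∈ G with i < a, p ^ ((H.card : ℤ) - (thetaSet {a} G : ℤ)) *
          alpha p (G.erase a) H) := by
    rw [Finset.mul_sum, Finset.mul_sum]
    refine Finset.sum_congr rfl fun a ha => ?_
    obtain ⟨haG, hia⟩ := Finset.mem_filter.1 ha
    have hHa : ∀ c ∈ H, c < a := fun c hc => (hD c (hH hc)).trans hia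
    have haB : a ∉ exchange E G H := by
      simp only [exchange, Finset.mem_union, Finset.mem_sdiff, not_or, not_and, not_not]
      exact ⟨fun _ => haG, fun h => lt_irrefl _ (hHa a h)⟩
    have hBa : exchange E (G.erase a) H = insert a (exchange E G H) := by
      rw [exchange, exchange, ← Finset.insert_union, Finset.sdiff_erase (hG haG)]
    have h1 := thetaSet_union_right {a} (Finset.sdiff_disjoint (s := G) (t := E))
    rw [Finset.sdiff_union_of_subset hG] at h1
    have h2 := thetaSet_insert_left (Finset.notMem_erase a G) E
    rw [Finset.insert_erase haG] at h2
    have h3 := thetaSet_union_right {a} hEH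
    rw [thetaSet_singleton_eq_card hHa] at h3
    have h4 := Finset.card_erase_add_one haG
    have h5 : thetaSet {a} (insert a (exchange E G H)) = thetaSet {a} (E \ G) + H.card := by
      rw [thetaSet_insert_right _ haB, thetaSet_singleton, theta_self, zero_add, exchange, h3]
    -- Since `a ∈ G`, this holds for truncated subtraction too: one more in `H` and one fewer in `G`
    -- have the same effect.
    have h6 : (insert i H).card - G.card = H.card - (G.erase a).card := by
      rw [Finset.card_insert_of_notMem hiH]; omega
    -- Follows from `θ_{G,E} = θ_{a,E} + θ_{G \ a,E}` and `θ_{a,E} = θ_{a,E \ G} + θ_{a,G}`. The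
    -- exponent is an integer because `|H| - θ_{a,G}` may be negative.
    have h7 : p ^ (thetaSet {a} (E \ G) + H.card) * p ^ thetaSet (G.erase a) E =
        p ^ thetaSet G E * p ^ ((H.card : ℤ) - (thetaSet {a} G : ℤ)) := by
      rw [← pow_add, ← zpow_natCast, ← zpow_natCast, ← zpow_add₀ hp]
      congr 1
      omega
    rw [disjointCoeff, hBa, hY haB hia.le, h5, h6, hcardA hG,
      hcardA ((Finset.erase_subset _ _).trans hG), ← h4, pow_add, pow_add p (thetaSet G E), ← add_assoc,
      pow_succ]
    linear_combination (t ^ (D \ H).card * t ^ (G.erase a).card * t *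
      pochhammer (t * p ^ E.card) p (H.card - (G.erase a).card) *
      p ^ thetaSet (D \ H) (exchange E G H) * (p - 1) * alpha p (G.erase a) H) * h7
  have hfst : (1 - t * p ^ (exchange E G H).card) *
      pochhammer (t * p ^ E.card) p (H.card - G.card) * alpha p G H =
      pochhammer (t * p ^ E.card) p ((insert i H).card - G.card) * alpha p G H := by
    -- As `|E'| = |E| + |H| - |G|`, the new factor is the next one of the Pochhammer symbol. For
    -- `|H| < |G|` truncation would break this, but then `α` vanishes.
    rcases lt_or_ge H.card G.card with h | h
    · rw [alpha_eq_zero p h, mul_zero, mul_zero]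
    · rw [Finset.card_insert_of_notMem hiH, Nat.sub_add_comm h, pochhammer, pochhammer,
        Finset.prod_range_succ, mul_assoc t, ← pow_add, ← Nat.add_sub_assoc h, ← hcardB,
        Nat.add_sub_cancel]
      ring
  rw [hsum, disjointCoeff, disjointCoeff, hA, hDi, hB, hY hiB le_rfl,
    alpha_insert_right hp (fun c hc => hD c (hH hc)) hiG]
  linear_combination -(t ^ (exchange D H G).card *
    p ^ (thetaSet G E + thetaSet (D \ H) (exchange E G H))) * hfst

/-- The three groups of terms: `i` stays in `F'`, `i` enters `E'` directly, `i` displaces `a`. In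
the first, `t p^θ_{i,E'}` is exactly the change of the coefficient when `D` grows by `i`. -/
theorem disjointCoeff_smul_rhoAct (b : Module.Basis ι 𝔽 V) (p t : 𝔽) {E D G H : Finset ι} {i : ι}
    (h : i ∉ E ∧ Disjoint E D) (hi : ∀ c ∈ D, c < i) (hG : G ⊆ E) (hH : H ⊆ D) :
    disjointCoeff p t E G D H • rhoAct b p t (ExteriorAlgebra.ι 𝔽 (b i))
      (signedTensor b (exchange D H G) (exchange E G H)) = (-1 : 𝔽) ^ thetaSet E {i} •
    (disjointCoeff p t E G (insert i D) H •
        signedTensor b (exchange (insert i D) H G) (exchange E G H) +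
      ((1 - t * p ^ (exchange E G H).card) * disjointCoeff p t E G D H) •
        signedTensor b (exchange D H G) (insert i (exchange E G H)) +
      ∑ a ∈ E \ G with i < a, (t * (p - 1) * p ^ thetaSet {a} (exchange E G H) *
        disjointCoeff p t E G D H) •
        signedTensor b (exchange D H (insert a G))
          (insert i (exchange E (insert a G) H))) := by
  have hiD : i ∉ D := fun h => lt_irrefl _ (hi i h)
  have hU : exchange D H G ∪ exchange E G H = E ∪ D := by
    ext c
    have h1 := @hG c
    have h2 := @hH c
    simp only [exchange, Finset.mem_union, Finset.mem_sdiff]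
    tauto
  have hAB : Disjoint (exchange D H G) (exchange E G H) := by
    rw [Finset.disjoint_left]
    intro c
    have h1 := @hG c
    have h2 := @hH c
    have h3 : c ∈ E → c ∉ D := fun hc => Finset.disjoint_left.1 h.2 hc
    simp only [exchange, Finset.mem_union, Finset.mem_sdiff]
    tauto
  have hiU : i ∉ exchange D H G ∪ exchange E G H := by
    rw [hU, Finset.mem_union, not_or]
    exact ⟨h.1, hiD⟩
  rw [Finset.mem_union, not_or] at hiU
  -- The elements of `H` are below `i` because `D` is processed in increasing order, so only
  -- elements of `E \ G` can be displaced.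
  have hfil : (exchange E G H).filter (i < ·) = (E \ G).filter (i < ·) := by
    rw [exchange, Finset.filter_union, Finset.filter_false_of_mem (s := H)
      fun c hc => (hi c (hH hc)).not_gt, Finset.union_empty]
  have hDH : insert i D \ H = insert i (D \ H) :=
    Finset.insert_sdiff_of_notMem _ fun hiH => hiD (hH hiH)
  have hiDH : i ∉ D \ H := fun h => hiD (Finset.sdiff_subset h)
  have hA : exchange (insert i D) H G = insert i (exchange D H G) := by
    rw [exchange, hDH, Finset.insert_union, exchange]
  rw [rhoAct_signedTensor b p t hAB hiU.1 hiU.2, hU, thetaSet_union_left h.2,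
    thetaSet_eq_zero (A := D) (C := {i}) (by simpa using fun c hc => (hi c hc).le), add_zero,
    smul_comm (disjointCoeff p t E G D H), hfil]
  congr 1
  rw [smul_add, smul_add, smul_smul, smul_smul, Finset.smul_sum]
  congr 1
  · congr 1
    · rw [hA]
      congr 1
      rw [disjointCoeff, disjointCoeff, hA, Finset.card_insert_of_notMem hiU.1, hDH,
        thetaSet_insert_left hiDH]
      ring
    · rw [mul_comm]
  · refine Finset.sum_congr rfl fun a ha => ?_
    have haE := (Finset.mem_filter.1 ha).1
    have haH : a ∉ H := fun haH =>
      Finset.disjoint_left.1 h.2 (Finset.sdiff_subset haE) (hH haH)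
    rw [smul_smul, mul_comm]
    congr 2
    · ext c
      simp only [exchange, Finset.mem_union, Finset.mem_sdiff, Finset.mem_insert]
      tauto
    · congr 1
      ext c
      simp only [exchange, Finset.mem_union, Finset.mem_sdiff, Finset.mem_insert,
        Finset.mem_erase]
      by_cases hc : c = a
      · subst hc
        simp [haH]
      · tauto

/-- Collects the terms that land on `(G, H ∪ {i})`. The form `insert a (G.erase a)` is the one that
`sum_powerset_sum_sdiff` produces. -/
theorem disjointCoeff_insert_smul (b : Module.Basis ι 𝔽 V) {p : 𝔽} (hp : p ≠ 0) (t : 𝔽)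
    {E D G H : Finset ι} {i : ι} (h : i ∉ E ∧ Disjoint E D) (hi : ∀ c ∈ D, c < i) (hG : G ⊆ E)
    (hH : H ⊆ D) :
    ((1 - t * p ^ (exchange E G H).card) * disjointCoeff p t E G D H) •
        signedTensor b (exchange D H G) (insert i (exchange E G H)) +
      ∑ a ∈ G with i < a, (t * (p - 1) * p ^ thetaSet {a} (exchange E (G.erase a) H) *
        disjointCoeff p t E (G.erase a) D H) •
        signedTensor b (exchange D H (insert a (G.erase a)))
          (insert i (exchange E (insert a (G.erase a)) H)) =
    disjointCoeff p t E G (insert i D) (insert i H) •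
      signedTensor b (exchange (insert i D) (insert i H) G) (exchange E G (insert i H)) := by
  have hiD : i ∉ D := fun h => lt_irrefl _ (hi i h)
  have hA : exchange (insert i D) (insert i H) G = exchange D H G := by
    ext c
    have h2 := @hH c
    simp only [exchange, Finset.mem_union, Finset.mem_sdiff, Finset.mem_insert]
    by_cases hc : c = i
    · subst hc
      simp [hiD]
    · tauto
  have hB : exchange E G (insert i H) = insert i (exchange E G H) := by
    rw [exchange, exchange, Finset.union_insert]
  rw [disjointCoeff_insert hp t h.2 hi h.1 hG hH, add_smul, Finset.sum_smul, hA, hB]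
  congr 1
  refine Finset.sum_congr rfl fun a ha => ?_
  rw [Finset.insert_erase (Finset.mem_filter.1 ha).1]

theorem rho_tmul_of_disjoint (b : Module.Basis ι 𝔽 V) {p : 𝔽} (hp : p ≠ 0) (t : 𝔽)
    {E D : Finset ι} (h : Disjoint E D) :
    rho b p t (setBasis b E ⊗ₜ[𝔽] setBasis b D) =
      (-1 : 𝔽) ^ thetaSet E D • ∑ G ∈ E.powerset, ∑ H ∈ D.powerset,
        disjointCoeff p t E G D H • signedTensor b (exchange D H G) (exchange E G H) := by
  induction D using Finset.induction_on_max with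
  | empty =>
    rw [setBasis_empty, rho_tmul_one, Finset.powerset_empty, thetaSet_empty_right, pow_zero,
      one_smul, Finset.sum_eq_single ∅]
    · simp [disjointCoeff, exchange, signedTensor, thetaSet_empty_left, setBasis_empty, alpha,
        pochhammer]
    · intro G _ hG
      -- For empty `D` only `H = ∅` occurs, and `α_{G,∅} = 0` unless `G` is empty.
      rw [Finset.sum_singleton, disjointCoeff, alpha_eq_zero p (by simpa [Finset.card_pos,
        Finset.nonempty_iff_ne_empty] using hG), mul_zero, mul_zero, zero_smul]
    · simp
  | insert i D hi ih =>
    rw [Finset.disjoint_insert_right] at h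
    have hiD : i ∉ D := fun h => lt_irrefl _ (hi i h)
    rw [setBasis_insert_of_gt b hi, rho_tmul_mul, ih h.2, map_smul, map_sum,
      thetaSet_insert_right _ hiD, add_comm, pow_add, mul_smul]
    congr 1
    have hswap : ∀ f : Finset ι → Finset ι → ι → ExteriorAlgebra 𝔽 V ⊗[𝔽] ExteriorAlgebra 𝔽 V,
        ∑ G ∈ E.powerset, ∑ H ∈ D.powerset, ∑ a ∈ E \ G with i < a, f G H a =
        ∑ G ∈ E.powerset, ∑ H ∈ D.powerset, ∑ a ∈ G with i < a, f (G.erase a) H a := by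
      intro f
      rw [Finset.sum_comm, Finset.sum_comm (s := E.powerset)]
      exact Finset.sum_congr rfl fun H _ => sum_powerset_sum_sdiff E (i < ·) fun G a => f G H a
    simp only [map_sum, map_smul]
    rw [Finset.sum_congr rfl fun G hG => Finset.sum_congr rfl fun H hH =>
      disjointCoeff_smul_rhoAct b p t h hi (Finset.mem_powerset.1 hG) (Finset.mem_powerset.1 hH)]
    simp only [← Finset.smul_sum, Finset.sum_add_distrib]
    rw [hswap, add_assoc, ← Finset.sum_add_distrib,
      Finset.sum_congr rfl fun G (hG : G ∈ E.powerset) => (Finset.sum_add_distrib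
        (s := D.powerset)).symm.trans (Finset.sum_congr rfl fun H hH =>
        disjointCoeff_insert_smul b hp t h hi (Finset.mem_powerset.1 hG)
          (Finset.mem_powerset.1 hH)),
      ← Finset.sum_add_distrib]
    congr 1
    -- The two remaining sums are the parts `i ∉ H` and `i ∈ H` of the sum over subsets of `D ∪
    -- {i}`.
    exact Finset.sum_congr rfl fun G _ => (Finset.sum_powerset_insert hiD _).symm

/-! ### Arbitrary pairs of sets and the matrix coefficients. -/

/-- For `i ∈ E` both `f_E v_i` and `v_i f_{E \ a}` with `a ≠ i` contain `v_i` twice. Only the term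
`v_i ⊗ f_E` is left, and the second leg stays equal to `f_E` throughout. -/
theorem rho_tmul_of_subset (b : Module.Basis ι 𝔽 V) (p t : 𝔽) {E C : Finset ι} (h : C ⊆ E) :
    rho b p t (setBasis b E ⊗ₜ[𝔽] setBasis b C) =
      (t ^ C.card * (-1) ^ (E.card * C.card) * p ^ thetaSet C E) •
        (setBasis b C ⊗ₜ[𝔽] setBasis b E) := by
  induction C using Finset.induction_on_max with
  | empty => simp [setBasis_empty, rho_tmul_one, thetaSet_empty_left]
  | insert i C hi ih =>
    have hiC : i ∉ C := fun h => lt_irrefl _ (hi i h)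
    rw [Finset.insert_subset_iff] at h
    have h1 : setBasis b E * ExteriorAlgebra.ι 𝔽 (b i) = 0 := by
      rw [← setBasis_singleton]
      exact setBasis_mul_of_not_disjoint b (by simpa using h.1)
    rw [setBasis_insert_of_gt b hi, rho_tmul_mul, ih h.2, map_smul, rhoAct_tmul,
      rho_setBasis_tmul_ι, h1, Finset.sum_eq_zero]
    · rw [TensorProduct.tmul_zero, smul_zero, add_zero, sub_zero, map_smul, mulL_tmul,
        smul_smul, Finset.card_insert_of_notMem hiC, thetaSet_insert_left hiC]
      congr 1
      ring
    · intro a ha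
      rw [ι_mul_setBasis_of_mem b (Finset.mem_erase.2 ⟨(Finset.mem_filter.1 ha).2.ne, h.1⟩),
        TensorProduct.tmul_zero, smul_zero]

/-- Recovers `G` from `F'`, and with the roles exchanged `H` from `E'`. Hence distinct pairs `(G,
H)` give distinct basis tensors. -/
theorem exchange_sdiff_of_subset {E F G H : Finset ι} (hG : G ⊆ E \ F) (hH : H ⊆ F \ E) :
    exchange F H G \ F = G := by
  ext c
  have h1 := @hG c
  have h2 := @hH c
  simp only [exchange, Finset.mem_union, Finset.mem_sdiff] at *
  tauto

theorem rho_setBasis_tmul (b : Module.Basis ι 𝔽 V) {p : 𝔽} (hp : p ≠ 0) (t : 𝔽) (E F : Finset ι) :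
    rho b p t (setBasis b E ⊗ₜ[𝔽] setBasis b F) =
      (-1 : 𝔽) ^ (E.card * F.card) • ∑ G ∈ (E \ F).powerset, ∑ H ∈ (F \ E).powerset,
        (t ^ (exchange F H G).card * pochhammer (t * p ^ E.card) p (H.card - G.card) *
          beta p E G F H) • (setBasis b (exchange F H G) ⊗ₜ[𝔽] setBasis b (exchange E G H)) := by
  have hCD : Disjoint (E ∩ F) (F \ E) :=
    Finset.disjoint_sdiff.mono_left Finset.inter_subset_left
  have hF : E ∩ F ∪ F \ E = F := by
    ext c
    simp only [Finset.mem_union, Finset.mem_inter, Finset.mem_sdiff]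
    tauto
  have hfF : setBasis b F = (-1 : 𝔽) ^ thetaSet (E ∩ F) (F \ E) •
      (setBasis b (E ∩ F) * setBasis b (F \ E)) := by
    rw [setBasis_mul b hCD, hF, smul_smul, ← mul_pow, neg_one_mul, neg_neg, one_pow, one_smul]
  rw [hfF, TensorProduct.tmul_smul, map_smul, rho_tmul_mul,
    rho_tmul_of_subset b p t Finset.inter_subset_left, map_smul, rhoAct_tmul,
    rho_tmul_of_disjoint b hp t Finset.disjoint_sdiff, map_smul, map_sum,
    ← Finset.sum_subset (Finset.powerset_mono.2 (Finset.sdiff_subset (s := E) (t := F)))]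
  · simp only [Finset.smul_sum, map_sum]
    refine Finset.sum_congr rfl fun G hG => Finset.sum_congr rfl fun H hH => ?_
    rw [Finset.mem_powerset] at hG hH
    have hCD' : Disjoint (E ∩ F) (exchange (F \ E) H G) := by
      rw [Finset.disjoint_left]
      intro c
      have h1 := @hG c
      simp only [exchange, Finset.mem_union, Finset.mem_sdiff, Finset.mem_inter] at *
      tauto
    have hF' : E ∩ F ∪ exchange (F \ E) H G = exchange F H G := by
      ext c
      have h2 := @hH c
      simp only [exchange, Finset.mem_union, Finset.mem_sdiff, Finset.mem_inter] at *
      tauto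
    have hDE : Disjoint (exchange (F \ E) H G) (exchange E G H) := by
      rw [Finset.disjoint_left]
      intro c
      have h1 := @hG c
      have h2 := @hH c
      simp only [exchange, Finset.mem_union, Finset.mem_sdiff] at *
      tauto
    have hU : exchange (F \ E) H G ∪ exchange E G H = F \ E ∪ E := by
      ext c
      have h1 := @hG c
      have h2 := @hH c
      simp only [exchange, Finset.mem_union, Finset.mem_sdiff] at *
      tauto
    have hGC : Disjoint G (E ∩ F) := by
      rw [Finset.disjoint_left]
      intro c hc
      have h1 := hG hc
      simp only [Finset.mem_sdiff, Finset.mem_inter] at *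
      tauto
    have c1 : F.card = (E ∩ F).card + (F \ E).card := by
      rw [← Finset.card_union_of_disjoint hCD, hF]
    have c2 : (exchange F H G).card = (E ∩ F).card + (exchange (F \ E) H G).card := by
      rw [← Finset.card_union_of_disjoint hCD', hF']
    have e1 := thetaSet_union_left hCD E
    have e2 := thetaSet_union_left hCD' (exchange E G H)
    have e3 := thetaSet_union_right (E ∩ F) hDE
    have e4 := thetaSet_union_right (E ∩ F) (Finset.sdiff_disjoint (s := E) (t := F))
    have e5 := thetaSet_add_thetaSet (Finset.disjoint_sdiff (s := E) (t := F))
    have e6 := mul_add E.card (E ∩ F).card (F \ E).card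
    rw [hF] at e1
    rw [hF'] at e2
    rw [hU, e4] at e3
    rw [← c1] at e6
    -- The signs of splitting `F` as `C ⊔ D`, of the actions of `C` and `D`, and of joining `C` to
    -- the first leg. They match because `θ_{C,D} + θ_{C,E}` is unchanged by the exchange (`e3`) and
    -- `θ_{E,D} + θ_{D,E} = |E||D|` (`e5`).
    have e := neg_one_pow_congr_mod (𝔽 := 𝔽)
      (m := thetaSet (E ∩ F) (F \ E) + E.card * (E ∩ F).card + thetaSet E (F \ E) +
        thetaSet (exchange (F \ E) H G) (exchange E G H) +
        thetaSet (E ∩ F) (exchange (F \ E) H G))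
      (n := E.card * F.card + (thetaSet F E + thetaSet (exchange F H G) (exchange E G H)))
      (by omega)
    rw [map_smul, signedTensor, map_smul, mulL_tmul, setBasis_mul b hCD', hF', ← TensorProduct.smul_tmul']
    simp only [smul_smul]
    congr 1
    rw [disjointCoeff, beta, c2, thetaSet_union_left hGC]
    simp only [pow_add] at e ⊢
    linear_combination (t ^ (E ∩ F).card * t ^ (exchange (F \ E) H G).card *
      pochhammer (t * p ^ E.card) p (H.card - G.card) * p ^ thetaSet (E ∩ F) E *
      p ^ thetaSet G E * p ^ thetaSet ((F \ E) \ H) (exchange E G H) * alpha p G H) * e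
  · intro G hG hG'
    rw [map_sum]
    refine Finset.sum_eq_zero fun H hH => ?_
    rw [Finset.mem_powerset] at hG hG'
    -- A set `G ⊆ E` not contained in `E \ F` meets `C`; multiplying by `f_C` then repeats a
    -- generator.
    obtain ⟨c, hc, hc'⟩ := Finset.not_subset.1 hG'
    rw [map_smul, signedTensor, map_smul, mulL_tmul, setBasis_mul_of_not_disjoint b,
      TensorProduct.zero_tmul, smul_zero, smul_zero]
    rw [Finset.not_disjoint_iff]
    refine ⟨c, ?_, Finset.mem_union_right _ hc⟩
    have := hG hc
    simp only [Finset.mem_sdiff, Finset.mem_inter] at *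
    tauto

theorem rhoCoeff_eq (b : Module.Basis ι 𝔽 V) {p : 𝔽} (hp : p ≠ 0) (t : 𝔽) {E F G H : Finset ι}
    (hG : G ⊆ E \ F) (hH : H ⊆ F \ E) :
    rhoCoeff b p t E G F H = t ^ (exchange F H G).card *
      pochhammer (t * p ^ E.card) p (H.card - G.card) * beta p E G F H := by
  rw [rhoCoeff, rho_setBasis_tmul b hp, map_smul, Finsupp.smul_apply, smul_eq_mul, ← mul_assoc,
    ← mul_pow, neg_one_mul, neg_neg, one_pow, one_mul, map_sum, Finsupp.finsetSum_apply,
    Finset.sum_eq_single G, map_sum, Finsupp.finsetSum_apply, Finset.sum_eq_single H]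
  · rw [map_smul, Finsupp.smul_apply, smul_eq_mul, Module.Basis.tensorProduct_repr_tmul_apply,
      Module.Basis.repr_self, Module.Basis.repr_self, Finsupp.single_eq_same,
      Finsupp.single_eq_same, smul_eq_mul, one_mul, mul_one]
  · intro H' hH' hne
    rw [Finset.mem_powerset] at hH'
    rw [map_smul, Finsupp.smul_apply, Module.Basis.tensorProduct_repr_tmul_apply,
      Module.Basis.repr_self, Module.Basis.repr_self, Finsupp.single_eq_of_ne
        (a := exchange E G H'), zero_smul, smul_zero]
    intro heq
    rw [← exchange_sdiff_of_subset hH' hG, ← exchange_sdiff_of_subset hH hG, heq] at hne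
    exact hne rfl
  · exact fun h => absurd (Finset.mem_powerset.2 hH) h
  · intro G' hG' hne
    rw [Finset.mem_powerset] at hG'
    rw [map_sum, Finsupp.finsetSum_apply]
    refine Finset.sum_eq_zero fun H' hH' => ?_
    rw [Finset.mem_powerset] at hH'
    rw [map_smul, Finsupp.smul_apply, Module.Basis.tensorProduct_repr_tmul_apply,
      Module.Basis.repr_self, Module.Basis.repr_self, Finsupp.single_eq_of_ne
        (a := exchange F H' G'), smul_zero, smul_zero]
    intro heq
    rw [← exchange_sdiff_of_subset hG' hH', ← exchange_sdiff_of_subset hG hH, heq] at hne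
    exact hne rfl
  · exact fun h => absurd (Finset.mem_powerset.2 hG) h

end HeckeExterior

end

theorem mainTheorem8 {𝔽 V ι : Type*} [Field 𝔽] [AddCommGroup V] [Module 𝔽 V] [LinearOrder ι]
    (b : Module.Basis ι 𝔽 V) (p t : 𝔽) (hp : p ≠ 0) (ht : t ≠ 0) :
    (∀ E F : Finset ι,
      HeckeExterior.rho b p t
          (HeckeExterior.setBasis b E ⊗ₜ[𝔽] HeckeExterior.setBasis b F) =
        (-1 : 𝔽) ^ (E.card * F.card) •
          ∑ G ∈ (E \ F).powerset, ∑ H ∈ (F \ E).powerset with G.card ≤ H.card,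
            HeckeExterior.rhoCoeff b p t E G F H •
              (HeckeExterior.setBasis b (HeckeExterior.exchange F H G) ⊗ₜ[𝔽]
                HeckeExterior.setBasis b (HeckeExterior.exchange E G H))) ∧
    ∀ E F G H : Finset ι, G ⊆ E \ F → H ⊆ F \ E → G.card ≤ H.card →
      HeckeExterior.rhoCoeff b p t E G F H =
        t ^ (HeckeExterior.exchange F H G).card *
          HeckeExterior.pochhammer (t * p ^ E.card) p (H.card - G.card) *
          HeckeExterior.beta p E G F H := by
  refine ⟨fun E F => ?_, fun E F G H hG hH _ => HeckeExterior.rhoCoeff_eq b hp t hG hH⟩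
  rw [HeckeExterior.rho_setBasis_tmul b hp]
  congr 1
  refine Finset.sum_congr rfl fun G hG => ?_
  rw [Finset.sum_filter]
  refine Finset.sum_congr rfl fun H hH => ?_
  split_ifs with h
  · rw [HeckeExterior.rhoCoeff_eq b hp t (Finset.mem_powerset.1 hG) (Finset.mem_powerset.1 hH)]
  -- The pairs with `|H| < |G|`, absent from the stated sum, have zero coefficient.
  · rw [HeckeExterior.beta, HeckeExterior.alpha_eq_zero p (not_le.1 h), mul_zero, mul_zero,
      zero_smul]
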